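/- Let $A$ be the mod $2$ Steenrod algebra, dual to $A_*=\mathbb F_2[\xi_1,\xi_2,\dots]$ with $\Delta\xi_n=\sum_{i+j=n}\xi_i^{2^j}\otimes\xi_j$ ($\xi_0=1$), with Milnor basis $\mathrm{Sq}(R)$ dual to $\xi^R$. Let $\Delta_t$ be the exponent sequence with $\xi^{\Delta_t}=\xi_t$, and $P_t^s=\mathrm{Sq}(2^s\Delta_t)$. For $a\in A$, $p\in A_*$ let $\mathrm{cont}(p,a)\in A$ be given by $\langle\mathrm{cont}(p,a),q\rangle=\langle a,pq\rangle$. Let $D_0$ be the (graded) dual of $\mathbb Z/4[\xi_n,2\xi_{k,l}]$ $(0\le k<l)$, with product dual to the coproduct that expresses composition modulo $4$ of power series $\sum_{k\ge0}\xi_kx^{2^k}+\sum_{0\le k<l}2\xi_{k,l}x^{2^k+2^l}$. Thus $D_0=\mathbb Z/4\{\mathrm{Sq}(R)\}\oplus\sum_{-1\le k<l}Y_{k,l}A$, with $\mathrm{Sq}(R)$ and $Y_{k,l}\mathrm{Sq}(R)$ dual to $\xi^R$ and $2\xi_{k+1,l+1}\xi^R$. Let $\pi:D_0\to A$ be the projection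 $\mathrm{Sq}(R)\mapsto\mathrm{Sq}(R)$, $Y_{k,l}a\mapsto0$, and $R_D=\ker\pi$. Let $D_1=(A+\mu_0A+\sum_{-1\le k,\,0\le l}U_{k,l}A)/{\sim}=A\oplus\mu_0A\oplus\bigoplus_{-1\le k<l}U_{k,l}A$, where $U_{k,l}=U_{l,k}+\mathrm{Sq}(\Delta_{k+1}+\Delta_{l+1})$ for $l<k$ and $U_{k,k}=\mu_0\mathrm{Sq}(\Delta_{k+2})+\mathrm{Sq}(2\Delta_{k+1})$, an $A$-bimodule with $$a\mu_0=\mu_0a+\mathrm{cont}(\xi_1,a),\qquad aU_{k,l}=\sum_{i,j\ge0}U_{k+i,l+j}\,\mathrm{cont}(\xi_i^{2^{k+1}}\xi_j^{2^{l+1}},a).$$ Let $\partial:D_1\to D_0$ be given by $\partial a=0$, $\partial(\mu_0a)=2a$, $\partial(U_{k,l}a)=Y_{k,l}a$. For sections $\sigma:A\to D_0$ of $\pi$ (with $\sigma(0)=0$) and $u:R_D\to D_1$ of $\partial$ ($u$ additive), put $\tau(a,b)=u(\sigma(ab)-\sigma(a)\sigma(b))$ and $$\langle a,b,c\rangle_{\sigma,u}=\tau(ab,c)-\tau(a,b)\sigma(c)-\tau(a,bc)+\sigma(a)\tau(b,c)\in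 D_1,$$ where $D_0$ acts on $D_1$ through $\pi$. The Massey product $\langle a,b,c\rangle\subseteq A$ is the set of values $\langle a,b,c\rangle_{\sigma,u}\in A\subset D_1$ for all choices of $(\sigma,u)$. The standard sections are $\sigma(\sum c_i\mathrm{Sq}(R_i))=\sum\widehat{c_i}\,\mathrm{Sq}(R_i)$ with $\widehat0=0$, $\widehat1=1\in\mathbb Z/4$, and $u(2\mathrm{Sq}(R))=\mu_0\mathrm{Sq}(R)$, $u(Y_{k,l}\mathrm{Sq}(R))=U_{k,l}\mathrm{Sq}(R)$ for $k<l$. **Corollary.** Let $t\ge1$. 1. If $s\ge 0$ and $s<t-1$, then $\langle P_t^s,P_t^s,P_t^s\rangle$ is zero: with the standard sections it equals $0$, and so $0\in\langle P_t^s,P_t^s,P_t^s\rangle$. 2. If $t\ge2$, then with the standard sections $\langle P_t^{t-1},P_t^{t-1},P_t^{t-1}\rangle$ equals $\mathrm{Sq}\big((2^{t-1}-1)\Delta_t+2\Delta_{2t-1}\big)$, and so $$\langle P_t^{t-1},P_t^{t-1},P_t^{t-1}\rangle\ni\mathrm{Sq}\big((2^{t-1}-1)\Delta_t+2\Delta_{2t-1}\big).$$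 For $t=1$, the product $\langle P_1^0,P_1^0,P_1^0\rangle=\langle\mathrm{Sq}^1,\mathrm{Sq}^1,\mathrm{Sq}^1\rangle$ is zero in the sense of 1. The case $t=2$ of 2 is the Kristensen–Madsen computation $\langle\mathrm{Sq}(0,2),\mathrm{Sq}(0,2),\mathrm{Sq}(0,2)\rangle\ni\mathrm{Sq}(0,1,2)$, with equality for the standard sections. -/

import Mathlib

namespace SecondarySteenrod

open MvPolynomial

noncomputable section

/-! ## Finiteness and homogeneity facts for dual algebras of polynomial coalgebras -/

/-- The value of `x ⊗ y` on `q`, where `x`, `y` are finite linear combinations of the functionals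
dual to the monomials of `k[σ]`, and `k[σ] ⊗ k[σ]` is written as the polynomial ring `k[σ ⊕ σ]`
(left tensor factor: `Sum.inl`, right tensor factor: `Sum.inr`). -/
def pair2 {σ k : Type*} [CommRing k] (x y : (σ →₀ ℕ) →₀ k) (q : MvPolynomial (σ ⊕ σ) k) : k :=
  x.sum fun m a => y.sum fun n b => a * b * coeff (m.sumElim n) q

theorem pair2_bound {σ k : Type*} [CommRing k] (w : σ → ℕ) (x y : (σ →₀ ℕ) →₀ k) :
    ∃ B : ℕ, ∀ (q : MvPolynomial (σ ⊕ σ) k) (N : ℕ),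
      IsWeightedHomogeneous (Sum.elim w w) q N → pair2 x y q ≠ 0 → N ≤ B := by
  refine ⟨x.support.sup (Finsupp.weight w) + y.support.sup (Finsupp.weight w), ?_⟩
  intro q N hq hne
  obtain ⟨m, hm, h1⟩ := Finset.exists_ne_zero_of_sum_ne_zero hne
  obtain ⟨n, hn, h2⟩ := Finset.exists_ne_zero_of_sum_ne_zero h1
  have h3 : coeff (m.sumElim n) q ≠ 0 := fun h => h2 (by simp [h])
  have h4 := hq h3
  have h5 : Finsupp.weight (Sum.elim w w) (m.sumElim n)
      = Finsupp.weight w m + Finsupp.weight w n := by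
    simp only [Finsupp.weight_apply]
    exact Finsupp.prod_sumElim (M := Multiplicative ℕ) m n
      (fun i c => Multiplicative.ofAdd (c • Sum.elim w w i))
  have h6 : Finsupp.weight w m ≤ x.support.sup (Finsupp.weight w) :=
    Finset.le_sup (f := Finsupp.weight w) hm
  have h7 : Finsupp.weight w n ≤ y.support.sup (Finsupp.weight w) :=
    Finset.le_sup (f := Finsupp.weight w) hn
  omega

theorem homogeneous_aeval {σ τ k : Type*} [CommRing k] (w : σ → ℕ) (w' : τ → ℕ)
    (f : σ → MvPolynomial τ k) (hf : ∀ i, IsWeightedHomogeneous w' (f i) (w i)) (m : σ →₀ ℕ) :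
    IsWeightedHomogeneous w' (aeval f (monomial m (1 : k))) (Finsupp.weight w m) := by
  rw [aeval_monomial, map_one, one_mul, Finsupp.weight_apply]
  exact IsWeightedHomogeneous.prod _ _ _ fun i _ => by
    simpa using (hf i).pow (m i)

theorem finite_weight_le {σ : Type*} (w : σ → ℕ) (hw : ∀ i, w i ≠ 0)
    (hfin : ∀ N, {i | w i ≤ N}.Finite) (N : ℕ) :
    {m : σ →₀ ℕ | Finsupp.weight w m ≤ N}.Finite := by
  classical
  refine Set.Finite.subset
    (Finset.finite_toSet ((hfin N).toFinset.finsupp fun _ => Finset.range (N + 1))) ?_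
  intro m hm
  simp only [Finset.mem_coe, Finset.mem_finsupp_iff]
  constructor
  · intro i hi
    rw [Set.Finite.mem_toFinset]
    exact (Finsupp.le_weight_of_ne_zero' w (Finsupp.mem_support_iff.1 hi)).trans hm
  · intro i _
    have := (Finsupp.le_weight w (hw i) m).trans hm
    simp only [Finset.mem_range]
    omega

/-! ## The Steenrod algebra -/

/-- Exponent sequences `R = (r₁, r₂, …)`; the entry `r_{n+1}` is `R n`. -/
abbrev Exponent := ℕ →₀ ℕ

/-- `Δ_n`, the exponent sequence with `ξ^{Δ_n} = ξ_n`, where `ξ_0 = 1`. -/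
def expDelta : ℕ → Exponent
  | 0 => 0
  | n + 1 => Finsupp.single n 1

/-- `ξ_n` with `ξ_0 = 1`, if `ξ_{n+1}` is given by `v n`. -/
def xi {K : Type*} [CommRing K] (v : ℕ → K) : ℕ → K
  | 0 => 1
  | n + 1 => v n

/-- `ξ_{n-k}`, which is zero for `k > n`. -/
def xiSub {K : Type*} [CommRing K] (v : ℕ → K) (n k : ℕ) : K :=
  if k ≤ n then xi v (n - k) else 0

/-- The degree `2^{n+1} - 1` of `ξ_{n+1}`. -/
def wtA (n : ℕ) : ℕ := 2 ^ (n + 1) - 1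

/-- The coproduct of the dual Steenrod algebra `A_* = 𝔽₂[ξ₁, ξ₂, …]`:
`Δ ξ_n = ∑_{i+j=n} ξ_i^{2^j} ⊗ ξ_j`. -/
def coprodA : MvPolynomial ℕ (ZMod 2) →ₐ[ZMod 2] MvPolynomial (ℕ ⊕ ℕ) (ZMod 2) :=
  aeval fun n => ∑ j ∈ Finset.range (n + 2),
    xiSub (fun i => X (Sum.inl i)) (n + 1) j ^ 2 ^ j * xi (fun i => X (Sum.inr i)) j

theorem homogeneous_xi {τ k : Type*} [CommRing k] (w : τ → ℕ) (f : ℕ → τ)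
    (hf : ∀ n, w (f n) = wtA n) (n : ℕ) :
    IsWeightedHomogeneous w (xi (fun i => (X (f i) : MvPolynomial τ k)) n) (2 ^ n - 1) := by
  cases n with
  | zero => simpa [xi] using isWeightedHomogeneous_one k w
  | succ n => simpa [xi, hf, wtA] using isWeightedHomogeneous_X k w (f n)

theorem homogeneous_xiSub {τ k : Type*} [CommRing k] (w : τ → ℕ) (f : ℕ → τ)
    (hf : ∀ n, w (f n) = wtA n) (n j : ℕ) :
    IsWeightedHomogeneous w (xiSub (fun i => (X (f i) : MvPolynomial τ k)) n j ^ 2 ^ j)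
      (2 ^ n - 2 ^ j) := by
  unfold xiSub
  split_ifs with h
  · have := (homogeneous_xi (k := k) w f hf (n - j)).pow (2 ^ j)
    convert this using 1
    rw [smul_eq_mul, Nat.mul_sub, mul_one, ← pow_add]
    congr 2
    omega
  · rw [zero_pow (by positivity)]
    exact isWeightedHomogeneous_zero _ _ _

theorem homogeneous_coprodA (m : Exponent) :
    IsWeightedHomogeneous (Sum.elim wtA wtA) (coprodA (monomial m 1)) (Finsupp.weight wtA m) := by
  refine homogeneous_aeval _ _ _ (fun n => ?_) m
  refine IsWeightedHomogeneous.sum _ _ _ fun j hj => ?_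
  have h1 := homogeneous_xiSub (k := ZMod 2) (Sum.elim wtA wtA) Sum.inl (fun _ => rfl) (n + 1) j
  have h2 := homogeneous_xi (k := ZMod 2) (Sum.elim wtA wtA) Sum.inr (fun _ => rfl) j
  convert h1.mul h2 using 1
  have h3 : 2 ^ j ≤ 2 ^ (n + 1) :=
    Nat.pow_le_pow_right (by norm_num) (by simp only [Finset.mem_range] at hj; omega)
  have h4 : 1 ≤ 2 ^ j := Nat.one_le_two_pow
  simp only [wtA]
  omega

theorem le_wtA (n : ℕ) : n + 1 ≤ wtA n := by
  have : n + 1 < 2 ^ (n + 1) := Nat.lt_two_pow_self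
  unfold wtA
  omega

theorem finite_wtA_le (N : ℕ) : {m : Exponent | Finsupp.weight wtA m ≤ N}.Finite :=
  finite_weight_le wtA (fun i => by have := le_wtA i; omega)
    (fun N => (Set.finite_le_nat N).subset fun i (hi : wtA i ≤ N) => by
      have := le_wtA i
      show i ≤ N
      omega) N

/-- The mod 2 Steenrod algebra `A`, the graded dual of `A_*`, in its Milnor basis: the
coefficient of `Sq(R)`, the functional dual to `ξ^R`, is the value at `R`. -/
def SteenrodAlgebra := Exponent →₀ ZMod 2

instance : AddCommGroup SteenrodAlgebra := inferInstanceAs (AddCommGroup (Exponent →₀ ZMod 2))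

/-- The product of `A` is dual to the coproduct of `A_*`: `⟨ab, p⟩ = ⟨a ⊗ b, Δ p⟩`. -/
def mulA (a b : Exponent →₀ ZMod 2) : Exponent →₀ ZMod 2 :=
  Finsupp.ofSupportFinite (fun R => pair2 a b (coprodA (monomial R 1))) <| by
    obtain ⟨B, hB⟩ := pair2_bound wtA a b
    exact (finite_wtA_le B).subset fun R hR => hB _ _ (homogeneous_coprodA R) hR

instance : Mul SteenrodAlgebra := ⟨mulA⟩

/-- The Milnor basis element `Sq(R)`. -/
def Sq (R : Exponent) : SteenrodAlgebra := Finsupp.single R (1 : ZMod 2)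

/-- `P_t^s = Sq(2^s Δ_t)`. -/
def P (t s : ℕ) : SteenrodAlgebra := Sq (2 ^ s • expDelta t)

/-- The contraction by `ξ^S`, defined by `⟨cont(ξ^S, a), q⟩ = ⟨a, ξ^S q⟩`. -/
def cont (S : Exponent) (a : SteenrodAlgebra) : SteenrodAlgebra :=
  Finsupp.comapDomain (M := ZMod 2) (fun R : Exponent => S + R) a (add_right_injective S).injOn

/-- `κ(a) = cont(ξ₁, a)`. -/
def kappa (a : SteenrodAlgebra) : SteenrodAlgebra := cont (expDelta 1) a

/-- The largest `i` such that `ξ_i` occurs in a `ξ^R` for which `Sq(R)` occurs in `a`. -/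
def maxIndex (a : SteenrodAlgebra) : ℕ :=
  (Finsupp.support (M := ZMod 2) a).sup fun R => R.support.sup fun n => n + 1

/-- Contractions by multiples of `ξ_i` vanish for `i` above `maxIndex a`. -/
theorem cont_eq_zero (a : SteenrodAlgebra) (i : ℕ) (hi : maxIndex a < i) (S : Exponent)
    (hS : expDelta i ≤ S) : cont S a = 0 := by
  refine Finsupp.ext (M := ZMod 2) fun R => ?_
  change (show Exponent →₀ ZMod 2 from a) (S + R) = 0
  by_contra h
  obtain ⟨n, rfl⟩ : ∃ n, i = n + 1 := ⟨i - 1, by omega⟩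
  have h1 : 1 ≤ (S + R) n := by
    have := hS n
    simp only [expDelta, Finsupp.single_eq_same] at this
    simp only [Finsupp.add_apply]
    omega
  have h2 : n + 1 ≤ (S + R).support.sup fun n => n + 1 :=
    Finset.le_sup (f := fun n => n + 1) (Finsupp.mem_support_iff.2 (by omega))
  have h3 : ((S + R).support.sup fun n => n + 1) ≤ maxIndex a :=
    Finset.le_sup (f := fun R : Exponent => R.support.sup fun n => n + 1)
      (Finsupp.mem_support_iff.2 h)
  omega

theorem zero_mulA (a : SteenrodAlgebra) : (0 : SteenrodAlgebra) * a = 0 :=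
  Finsupp.ext (M := ZMod 2) fun R =>
    show pair2 (0 : Exponent →₀ ZMod 2) a (coprodA (monomial R 1)) = 0 from Finsupp.sum_zero_index

/-! ## The Hopf algebra `D₀` -/

/-- The pairs `k < l`. -/
abbrev Pair := {p : ℕ × ℕ // p.1 < p.2}

/-- The indices of the variables `ξ_{n+1}` (`Sum.inl n`) and `ξ_{k,l}`, `0 ≤ k < l`
(`Sum.inr (k, l)`). -/
abbrev Idx := ℕ ⊕ Pair

/-- The degrees of `ξ_{n+1}` and `ξ_{k,l}`. -/
def wtD : Idx → ℕ := Sum.elim wtA fun p => 2 ^ p.1.1 + 2 ^ p.1.2 - 1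

/-- `ξ_{n-k} ⊗ 1`. -/
def xiL (n k : ℕ) : MvPolynomial (Idx ⊕ Idx) (ZMod 4) :=
  xiSub (fun i => X (Sum.inl (Sum.inl i))) n k

/-- `1 ⊗ ξ_n`. -/
def xiR (n : ℕ) : MvPolynomial (Idx ⊕ Idx) (ZMod 4) :=
  xi (fun i => X (Sum.inr (Sum.inl i))) n

/-- `1 ⊗ ξ_{k,l}`. -/
def xiPairR (p : Pair) : MvPolynomial (Idx ⊕ Idx) (ZMod 4) := X (Sum.inr (Sum.inr p))

/-- The coproducts of `ξ_{n+1}` and `ξ_{n,m}` that express the composition modulo 4 of power series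
`∑_{k ≥ 0} ξ_k x^{2^k} + ∑_{0 ≤ k < l} 2 ξ_{k,l} x^{2^k + 2^l}`:
* `Δ ξ_n = ∑_{i+j=n} ξ_i^{2^j} ⊗ ξ_j + 2 ∑_{k<l} ξ_{n-1-k}^{2^k} ξ_{n-1-l}^{2^l} ⊗ ξ_{k,l}`,
* `Δ ξ_{n,m} = ξ_{n,m} ⊗ 1 + ∑_k ξ_{n-k}^{2^k} ξ_{m-k}^{2^k} ⊗ ξ_{k+1}
  + ∑_{k<l} (ξ_{n-k}^{2^k} ξ_{m-l}^{2^l} + ξ_{m-k}^{2^k} ξ_{n-l}^{2^l}) ⊗ ξ_{k,l}`. -/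
def coprodDGen : Idx → MvPolynomial (Idx ⊕ Idx) (ZMod 4)
  | Sum.inl n =>
      ∑ j ∈ Finset.range (n + 2), xiL (n + 1) j ^ 2 ^ j * xiR j
      + 2 * ∑ l ∈ Finset.range (n + 1), ∑ k : Fin l,
          xiL n k ^ 2 ^ (k : ℕ) * xiL n l ^ 2 ^ l * xiPairR ⟨(k, l), k.2⟩
  | Sum.inr p =>
      X (Sum.inl (Sum.inr p))
      + ∑ k ∈ Finset.range (p.1.1 + 1),
          xiL p.1.1 k ^ 2 ^ k * xiL p.1.2 k ^ 2 ^ k * xiR (k + 1)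
      + ∑ l ∈ Finset.range (p.1.2 + 1), ∑ k : Fin l,
          (xiL p.1.1 k ^ 2 ^ (k : ℕ) * xiL p.1.2 l ^ 2 ^ l
            + xiL p.1.2 k ^ 2 ^ (k : ℕ) * xiL p.1.1 l ^ 2 ^ l) * xiPairR ⟨(k, l), k.2⟩

/-- The coproduct on `ℤ/4[ξ_n, ξ_{k,l}]`; it is only used on the subring
`D_{0*} = ℤ/4[ξ_n, 2ξ_{k,l}]`. -/
def coprodD : MvPolynomial Idx (ZMod 4) →ₐ[ZMod 4] MvPolynomial (Idx ⊕ Idx) (ZMod 4) :=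
  aeval coprodDGen

theorem homogeneous_xiL_mul (n m k l : ℕ) (e : ℕ)
    (q : MvPolynomial (Idx ⊕ Idx) (ZMod 4))
    (hq : IsWeightedHomogeneous (Sum.elim wtD wtD) q e) (N : ℕ)
    (hN : k ≤ n → l ≤ m → 2 ^ n - 2 ^ k + (2 ^ m - 2 ^ l) + e = N) :
    IsWeightedHomogeneous (Sum.elim wtD wtD) (xiL n k ^ 2 ^ k * xiL m l ^ 2 ^ l * q) N := by
  by_cases h1 : k ≤ n
  · by_cases h2 : l ≤ m
    · rw [← hN h1 h2]
      exact ((homogeneous_xiSub _ (fun i => Sum.inl (Sum.inl i)) (fun _ => rfl) n k).mul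
        (homogeneous_xiSub _ (fun i => Sum.inl (Sum.inl i)) (fun _ => rfl) m l)).mul hq
    · have : xiL m l = 0 := if_neg h2
      rw [this, zero_pow (by positivity), mul_zero, zero_mul]
      exact isWeightedHomogeneous_zero _ _ _
  · have : xiL n k = 0 := if_neg h1
    rw [this, zero_pow (by positivity), zero_mul, zero_mul]
    exact isWeightedHomogeneous_zero _ _ _

theorem homogeneous_coprodDGen (i : Idx) :
    IsWeightedHomogeneous (Sum.elim wtD wtD) (coprodDGen i) (wtD i) := by
  have hR : ∀ n, IsWeightedHomogeneous (Sum.elim wtD wtD) (xiR n) (2 ^ n - 1) := fun n =>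
    homogeneous_xi _ (fun i => Sum.inr (Sum.inl i)) (fun _ => rfl) n
  have hP : ∀ p : Pair, IsWeightedHomogeneous (Sum.elim wtD wtD) (xiPairR p)
      (2 ^ p.1.1 + 2 ^ p.1.2 - 1) := fun p =>
    isWeightedHomogeneous_X (ZMod 4) (Sum.elim wtD wtD) (Sum.inr (Sum.inr p))
  have hpow : ∀ a b : ℕ, a ≤ b → 2 ^ a ≤ 2 ^ b := fun a b h =>
    Nat.pow_le_pow_right (by norm_num) h
  have hone : ∀ a : ℕ, 1 ≤ 2 ^ a := fun a => Nat.one_le_two_pow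
  rcases i with n | ⟨⟨n, m⟩, hnm⟩
  · refine IsWeightedHomogeneous.add ?_ ?_
    · refine IsWeightedHomogeneous.sum _ _ _ fun j hj => ?_
      have h1 := homogeneous_xiSub (k := ZMod 4) (Sum.elim wtD wtD) (fun i => Sum.inl (Sum.inl i))
        (fun _ => rfl) (n + 1) j
      have h3 := hpow j (n + 1) (Nat.lt_succ_iff.1 (Finset.mem_range.1 hj))
      have h4 := hone j
      have h5 : 2 ^ (n + 1) - 1 = 2 ^ (n + 1) - 2 ^ j + (2 ^ j - 1) := by omega
      change IsWeightedHomogeneous _ _ (2 ^ (n + 1) - 1)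
      rw [h5]
      exact h1.mul (hR j)
    · have h2 : (2 : MvPolynomial (Idx ⊕ Idx) (ZMod 4)) = C 2 := (map_ofNat C 2).symm
      rw [h2]
      refine IsWeightedHomogeneous.C_mul ?_ _
      refine IsWeightedHomogeneous.sum _ _ _ fun l _ => ?_
      refine IsWeightedHomogeneous.sum _ _ _ fun k _ => ?_
      refine homogeneous_xiL_mul _ _ _ _ _ _ (hP _) _ fun h1 h2 => ?_
      have h3 := hpow _ _ h1
      have h4 := hpow _ _ h2
      have h5 := hone k
      have h6 := hone l
      have h7 : 2 ^ (n + 1) = 2 * 2 ^ n := by ring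
      change _ = 2 ^ (n + 1) - 1
      dsimp only
      omega
  · refine IsWeightedHomogeneous.add (IsWeightedHomogeneous.add ?_ ?_) ?_
    · exact isWeightedHomogeneous_X (ZMod 4) (Sum.elim wtD wtD) _
    · refine IsWeightedHomogeneous.sum _ _ _ fun k _ => ?_
      refine homogeneous_xiL_mul _ _ _ _ _ _ (hR _) _ fun h1 h2 => ?_
      have h3 := hpow _ _ h1
      have h4 := hpow _ _ h2
      have h5 := hone k
      have h7 : 2 ^ (k + 1) = 2 * 2 ^ k := by ring
      change _ = 2 ^ n + 2 ^ m - 1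
      dsimp only at *
      omega
    · refine IsWeightedHomogeneous.sum _ _ _ fun l _ => ?_
      refine IsWeightedHomogeneous.sum _ _ _ fun k _ => ?_
      have h5 := hone k
      have h6 := hone l
      rw [add_mul]
      refine IsWeightedHomogeneous.add ?_ ?_
      all_goals
        refine homogeneous_xiL_mul _ _ _ _ _ _ (hP _) _ fun h1 h2 => ?_
        have h3 := hpow _ _ h1
        have h4 := hpow _ _ h2
        change _ = 2 ^ n + 2 ^ m - 1
        dsimp only at *
        omega

theorem homogeneous_coprodD (m : Idx →₀ ℕ) :
    IsWeightedHomogeneous (Sum.elim wtD wtD) (coprodD (monomial m 1)) (Finsupp.weight wtD m) :=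
  homogeneous_aeval _ _ _ homogeneous_coprodDGen m

theorem le_wtD_pair (p : Pair) : p.1.1 + p.1.2 + 1 ≤ wtD (Sum.inr p) := by
  have h1 : p.1.1 + 1 ≤ 2 ^ p.1.1 := Nat.lt_two_pow_self
  have h2 : p.1.2 + 1 ≤ 2 ^ p.1.2 := Nat.lt_two_pow_self
  simp only [wtD, Sum.elim_inr]
  omega

theorem finite_wtD_le (N : ℕ) : {m : Idx →₀ ℕ | Finsupp.weight wtD m ≤ N}.Finite := by
  refine finite_weight_le wtD ?_ ?_ N
  · rintro (n | p)
    · have := le_wtA n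
      simp only [wtD, Sum.elim_inl]
      omega
    · have := le_wtD_pair p
      omega
  · intro N
    have h1 : {n : ℕ | n ≤ N}.Finite := Set.finite_le_nat N
    have h2 : {p : Pair | p.1 ∈ {n : ℕ | n ≤ N} ×ˢ {n : ℕ | n ≤ N}}.Finite :=
      (h1.prod h1).preimage Subtype.val_injective.injOn
    refine ((h1.image Sum.inl).union (h2.image Sum.inr)).subset ?_
    rintro (n | p) hi
    · refine Or.inl ⟨n, ?_, rfl⟩
      have := le_wtA n
      change wtA n ≤ N at hi
      show n ≤ N
      omega
    · refine Or.inr ⟨p, ?_, rfl⟩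
      have := le_wtD_pair p
      change wtD (Sum.inr p) ≤ N at hi
      show p.1.1 ≤ N ∧ p.1.2 ≤ N
      omega

/-- `D₀`, the graded dual of `D_{0*} = ℤ/4[ξ_n, 2ξ_{k,l}]`, in the form
`ℤ/4{Sq(R)} ⊕ ∑_{k<l} Y_{k-1,l-1} A`. Here `Y_{k-1,l-1} Sq(R)` is the functional with value `2` on
`2 ξ_{k,l} ξ^R` and `0` on the other elements of the basis `{ξ^S, 2 ξ_{m,n} ξ^S}`, and `Sq(R)` is the
one with value `1` on `ξ^R` and `0` on the others. -/
def D0 := (Exponent →₀ ZMod 4) × (Pair →₀ SteenrodAlgebra)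

instance : AddCommGroup D0 :=
  inferInstanceAs (AddCommGroup ((Exponent →₀ ZMod 4) × (Pair →₀ SteenrodAlgebra)))

/-- The lift `ℤ/2 → ℤ/4`, `0 ↦ 0`, `1 ↦ 1`. -/
def lift (z : ZMod 2) : ZMod 4 := (z.val : ZMod 4)

/-- The exponent of `ξ^R` among the monomials of `ℤ/4[ξ_n, ξ_{k,l}]`. -/
def monoXi (R : Exponent) : Idx →₀ ℕ := R.mapDomain Sum.inl

/-- The exponent of `ξ_{k,l} ξ^R` among the monomials of `ℤ/4[ξ_n, ξ_{k,l}]`. -/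
def monoXiPair (p : Pair) (R : Exponent) : Idx →₀ ℕ := Finsupp.single (Sum.inr p) 1 + monoXi R

/-- The extension of a functional `d ∈ D₀` to `ℤ/4[ξ_n, ξ_{k,l}]`, as a linear combination of the
functionals dual to monomials. (The functional that is dual to the monomial `ξ_{k,l} ξ^R` restricts
to `Y_{k-1,l-1} Sq(R)` on `D_{0*}`.) -/
def D0.toDual (d : D0) : (Idx →₀ ℕ) →₀ ZMod 4 :=
  d.1.mapDomain monoXi +
    d.2.sum fun p a => Finsupp.sum (M := ZMod 2) a fun R z =>
      Finsupp.single (monoXiPair p R) (lift z)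

theorem monoXi_injective : Function.Injective monoXi :=
  Finsupp.mapDomain_injective Sum.inl_injective

theorem monoXi_inr (R : Exponent) (p : Pair) : monoXi R (Sum.inr p) = 0 :=
  Finsupp.mapDomain_of_notMem_range _ _ (by simp)

theorem monoXiPair_injective : Function.Injective fun q : Pair × Exponent => monoXiPair q.1 q.2 := by
  rintro ⟨p, R⟩ ⟨p', R'⟩ h
  have h1 : p = p' := by
    have h2 := DFunLike.congr_fun h (Sum.inr p)
    by_contra hne
    have h3 : (Sum.inr p' : Idx) ≠ Sum.inr p := fun h => hne (Sum.inr_injective h).symm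
    simp [monoXiPair, monoXi_inr, h3] at h2
  subst h1
  have h2 : monoXi R = monoXi R' := add_left_cancel h
  rw [monoXi_injective h2]

/-- The product of `D₀` is dual to the coproduct of `D_{0*}`: `⟨de, p⟩ = ⟨d ⊗ e, Δ p⟩` for
`p = ξ^R`, which gives the coefficient of `Sq(R)`, and for `p = 2 ξ_{k,l} ξ^R`, which gives twice the
coefficient of `Y_{k-1,l-1} Sq(R)`. -/
def mulD0 (d e : D0) : D0 :=
  (Finsupp.ofSupportFinite
      (fun R => pair2 d.toDual e.toDual (coprodD (monomial (monoXi R) 1))) <| by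
    obtain ⟨B, hB⟩ := pair2_bound wtD d.toDual e.toDual
    exact ((finite_wtD_le B).preimage monoXi_injective.injOn).subset
      fun R hR => hB _ _ (homogeneous_coprodD _) hR,
   Finsupp.curry (Finsupp.ofSupportFinite
      (fun q : Pair × Exponent => ZMod.castHom (show 2 ∣ 4 by norm_num) (ZMod 2)
        (pair2 d.toDual e.toDual (coprodD (monomial (monoXiPair q.1 q.2) 1)))) <| by
    obtain ⟨B, hB⟩ := pair2_bound wtD d.toDual e.toDual
    exact ((finite_wtD_le B).preimage monoXiPair_injective.injOn).subset
      fun q hq => hB _ _ (homogeneous_coprodD _) fun h => hq (by simp only [h, map_zero])))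

instance : Mul D0 := ⟨mulD0⟩

/-- The projection `π : D₀ → A` with `Sq(R) ↦ Sq(R)`, `Y_{k,l} a ↦ 0`. -/
def proj : D0 →+ SteenrodAlgebra where
  toFun d := Finsupp.mapRange (ZMod.castHom (show 2 ∣ 4 by norm_num) (ZMod 2)) (map_zero _) d.1
  map_zero' := Finsupp.mapRange_zero
  map_add' d e := Finsupp.mapRange_add (fun _ _ => map_add _ _ _) d.1 e.1

theorem proj_apply (d : D0) (R : Exponent) :
    (show Exponent →₀ ZMod 2 from proj d) R =
      ZMod.castHom (show 2 ∣ 4 by norm_num) (ZMod 2) (d.1 R) := rfl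

theorem pair2_add_left {σ k : Type*} [CommRing k] (x x' y : (σ →₀ ℕ) →₀ k)
    (q : MvPolynomial (σ ⊕ σ) k) : pair2 (x + x') y q = pair2 x y q + pair2 x' y q := by
  classical
  refine Finsupp.sum_add_index' (fun m => ?_) fun m a b => ?_
  · simp
  · rw [← Finsupp.sum_add]
    exact Finsupp.sum_congr fun n _ => by ring

theorem pair2_add_right {σ k : Type*} [CommRing k] (x y y' : (σ →₀ ℕ) →₀ k)
    (q : MvPolynomial (σ ⊕ σ) k) : pair2 x (y + y') q = pair2 x y q + pair2 x y' q := by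
  classical
  unfold pair2
  rw [← Finsupp.sum_add]
  refine Finsupp.sum_congr fun m _ => Finsupp.sum_add_index' (fun n => ?_) fun n a b => ?_
  · simp
  · ring

theorem pair2_eq_zero {σ k : Type*} [CommRing k] (x y : (σ →₀ ℕ) →₀ k)
    (q : MvPolynomial (σ ⊕ σ) k)
    (h : ∀ m ∈ x.support, ∀ n ∈ y.support, coeff (m.sumElim n) q = 0) : pair2 x y q = 0 :=
  Finset.sum_eq_zero fun m hm => Finset.sum_eq_zero fun n hn => by
    simp only [h m hm n hn, mul_zero]

theorem map_pair2 {σ k k' : Type*} [CommRing k] [CommRing k'] (φ : k →+* k')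
    (x y : (σ →₀ ℕ) →₀ k) (q : MvPolynomial (σ ⊕ σ) k) :
    φ (pair2 x y q) = pair2 (x.mapRange φ (map_zero φ)) (y.mapRange φ (map_zero φ))
      (MvPolynomial.map φ q) := by
  unfold pair2
  rw [Finsupp.sum_mapRange_index (fun m => by simp)]
  rw [map_finsuppSum]
  refine Finsupp.sum_congr fun m _ => ?_
  rw [Finsupp.sum_mapRange_index (fun m => by simp), map_finsuppSum]
  refine Finsupp.sum_congr fun n _ => ?_
  rw [map_mul, map_mul, coeff_map]

theorem monoXi_sumElim (R S : Exponent) :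
    (monoXi R).sumElim (monoXi S) = (R.sumElim S).mapDomain (Sum.map Sum.inl Sum.inl) := by
  rw [Finsupp.sumElim_eq_add, Finsupp.sumElim_eq_add, Finsupp.mapDomain_add, monoXi, monoXi,
    ← Finsupp.mapDomain_comp, ← Finsupp.mapDomain_comp, ← Finsupp.mapDomain_comp,
    ← Finsupp.mapDomain_comp]
  rfl

theorem coeff_rename_sumElim (m n : Idx →₀ ℕ) (q : MvPolynomial (ℕ ⊕ ℕ) (ZMod 2))
    (h : (∃ p, m (Sum.inr p) ≠ 0) ∨ ∃ p, n (Sum.inr p) ≠ 0) :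
    coeff (m.sumElim n) (rename (Sum.map Sum.inl Sum.inl : ℕ ⊕ ℕ → Idx ⊕ Idx) q) = 0 := by
  refine coeff_rename_eq_zero _ _ _ fun u hu => ?_
  exfalso
  rcases h with ⟨p, hp⟩ | ⟨p, hp⟩
  · apply hp
    have := DFunLike.congr_fun hu (Sum.inl (Sum.inr p))
    rw [Finsupp.mapDomain_of_notMem_range _ _ (by simp)] at this
    exact this.symm
  · apply hp
    have := DFunLike.congr_fun hu (Sum.inr (Sum.inr p))
    rw [Finsupp.mapDomain_of_notMem_range _ _ (by simp)] at this
    exact this.symm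

/-- The part of `d.toDual` that comes from the `Y_{k,l}`. -/
def D0.yDual (d : D0) : (Idx →₀ ℕ) →₀ ZMod 4 :=
  d.2.sum fun p a => Finsupp.sum (M := ZMod 2) a fun R z =>
    Finsupp.single (monoXiPair p R) (lift z)

theorem D0.yDual_support (d : D0) (m : Idx →₀ ℕ) (hm : d.yDual m ≠ 0) :
    ∃ p, m (Sum.inr p) ≠ 0 := by
  classical
  unfold D0.yDual at hm
  rw [Finsupp.sum, Finsupp.finsetSum_apply] at hm
  obtain ⟨p, _, h1⟩ := Finset.exists_ne_zero_of_sum_ne_zero hm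
  change (∑ R ∈ Finsupp.support (M := ZMod 2) (d.2 p),
    Finsupp.single (monoXiPair p R) (lift ((show Exponent →₀ ZMod 2 from d.2 p) R))) m ≠ 0 at h1
  rw [Finsupp.finsetSum_apply] at h1
  obtain ⟨R, _, h2⟩ := Finset.exists_ne_zero_of_sum_ne_zero h1
  refine ⟨p, ?_⟩
  have h3 : monoXiPair p R = m := by
    by_contra h
    exact h2 (Finsupp.single_eq_of_ne (Ne.symm h))
  rw [← h3]
  simp [monoXiPair]

theorem map_xiSub (φ : MvPolynomial (Idx ⊕ Idx) (ZMod 4) →+* MvPolynomial (Idx ⊕ Idx) (ZMod 2))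
    (v : ℕ → MvPolynomial (Idx ⊕ Idx) (ZMod 4)) (n k : ℕ) :
    φ (xiSub v n k) = xiSub (fun i => φ (v i)) n k := by
  unfold xiSub
  split_ifs
  · cases n - k <;> simp [xi]
  · simp

theorem map_coprodD (R : Exponent) :
    MvPolynomial.map (ZMod.castHom (show 2 ∣ 4 by norm_num) (ZMod 2))
        (coprodD (monomial (monoXi R) 1)) =
      rename (Sum.map Sum.inl Sum.inl) (coprodA (monomial R 1)) := by
  have h2 : (2 : MvPolynomial (Idx ⊕ Idx) (ZMod 2)) = 0 := CharP.cast_eq_zero _ 2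
  have hgen : ∀ n, MvPolynomial.map (ZMod.castHom (show 2 ∣ 4 by norm_num) (ZMod 2))
      (coprodDGen (Sum.inl n)) = rename (Sum.map Sum.inl Sum.inl) (coprodA (X n)) := by
    intro n
    simp only [coprodDGen, coprodA, map_add, map_mul, map_ofNat, h2, zero_mul, add_zero, aeval_X,
      map_sum, map_pow]
    refine Finset.sum_congr rfl fun j _ => ?_
    congr 1
    · congr 1
      unfold xiL xiSub
      split_ifs
      · cases n + 1 - j <;> simp [xi]
      · simp
    · unfold xiR
      cases j <;> simp [xi]
  have e1 : (monomial (monoXi R) (1 : ZMod 4)) = R.prod fun n c => (X (Sum.inl n)) ^ c := by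
    rw [monomial_eq, C_1, one_mul, monoXi, Finsupp.prod_mapDomain_index_inj Sum.inl_injective]
  have e2 : (monomial R (1 : ZMod 2)) = R.prod fun n c => (X n) ^ c := by
    rw [monomial_eq, C_1, one_mul]
  rw [e1, e2]
  unfold Finsupp.prod
  simp only [map_prod, map_pow]
  refine Finset.prod_congr rfl fun n _ => ?_
  rw [← hgen n, coprodD, aeval_X]

/-- The projection `π` is multiplicative. -/
theorem proj_mul (d e : D0) : proj (d * e) = proj d * proj e := by
  refine Finsupp.ext (M := ZMod 2) fun R => ?_
  change ZMod.castHom (show 2 ∣ 4 by norm_num) (ZMod 2)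
      (pair2 d.toDual e.toDual (coprodD (monomial (monoXi R) 1))) =
    pair2 (show Exponent →₀ ZMod 2 from proj d) (show Exponent →₀ ZMod 2 from proj e)
      (coprodA (monomial R 1))
  rw [map_pair2, map_coprodD]
  have hd : ∀ d : D0, d.toDual.mapRange (ZMod.castHom (show 2 ∣ 4 by norm_num) (ZMod 2))
      (map_zero _) = (show Exponent →₀ ZMod 2 from proj d).mapDomain monoXi +
        d.yDual.mapRange (ZMod.castHom (show 2 ∣ 4 by norm_num) (ZMod 2)) (map_zero _) := by
    intro d
    have : d.toDual = d.1.mapDomain monoXi + d.yDual := rfl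
    rw [this, Finsupp.mapRange_add (fun _ _ => map_add _ _ _)]
    congr 1
    exact (Finsupp.mapDomain_mapRange _ _ _ _ fun _ _ => map_add _ _ _).symm
  have hy : ∀ d : D0, ∀ m ∈ (d.yDual.mapRange (ZMod.castHom (show 2 ∣ 4 by norm_num) (ZMod 2))
      (map_zero _)).support, ∃ p, m (Sum.inr p) ≠ 0 := by
    intro d m hm
    refine d.yDual_support m fun h => ?_
    rw [Finsupp.mem_support_iff, Finsupp.mapRange_apply, h, map_zero] at hm
    exact hm rfl
  rw [hd d, hd e, pair2_add_left, pair2_add_right, pair2_eq_zero _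
    (e.yDual.mapRange (ZMod.castHom (show 2 ∣ 4 by norm_num) (ZMod 2)) (map_zero _)),
    pair2_eq_zero (d.yDual.mapRange (ZMod.castHom (show 2 ∣ 4 by norm_num) (ZMod 2)) (map_zero _)),
    add_zero, add_zero]
  · unfold pair2
    rw [Finsupp.sum_mapDomain_index_inj monoXi_injective]
    refine Finsupp.sum_congr fun m _ => ?_
    rw [Finsupp.sum_mapDomain_index_inj monoXi_injective]
    refine Finsupp.sum_congr fun n _ => ?_
    rw [monoXi_sumElim, coeff_rename_mapDomain _
      (Function.Injective.sumMap Sum.inl_injective Sum.inl_injective)]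
  · exact fun m hm n _ => coeff_rename_sumElim _ _ _ (Or.inl (hy d m hm))
  · exact fun m _ n hn => coeff_rename_sumElim _ _ _ (Or.inr (hy e n hn))

/-- `R_D = ker π`. -/
abbrev RD : AddSubgroup D0 := proj.ker

/-! ## The bimodule `D₁` -/

/-- `D₁ = A ⊕ μ₀ A ⊕ ∑_{-1 ≤ k < l} U_{k,l} A`. This is the quotient of
`A ⊕ μ₀ A ⊕ ∑_{-1 ≤ k, 0 ≤ l} U_{k,l} A` by the relations which express `U_{k,l}` with `l ≤ k` in
terms of the other generators (see `D1.U`). The coefficient of `U_{k-1,l-1}`, `0 ≤ k < l`, is stored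
at the pair `(k, l)`. -/
def D1 := SteenrodAlgebra × SteenrodAlgebra × (Pair →₀ SteenrodAlgebra)

instance : AddCommGroup D1 :=
  inferInstanceAs (AddCommGroup (SteenrodAlgebra × SteenrodAlgebra × (Pair →₀ SteenrodAlgebra)))

/-- The inclusion `A → D₁`. -/
def D1.incl (a : SteenrodAlgebra) : D1 := (a, 0, 0)

/-- The element `μ₀ a`. -/
def D1.mu (a : SteenrodAlgebra) : D1 := (0, a, 0)

/-- The element `U_{m-1,n-1} a` for `0 ≤ m`, `1 ≤ n`. With `k = m - 1`, `l = n - 1`: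
`U_{k,l} = U_{l,k} + Sq(Δ_{k+1} + Δ_{l+1})` for `l < k` and
`U_{k,k} = μ₀ Sq(Δ_{k+2}) + Sq(2Δ_{k+1})`. -/
def D1.U (m n : ℕ) (a : SteenrodAlgebra) : D1 :=
  if h : m < n then (0, 0, Finsupp.single ⟨(m, n), h⟩ a)
  else if h : n < m then
    (Sq (expDelta m + expDelta n) * a, 0, Finsupp.single ⟨(n, m), h⟩ a)
  else (Sq (2 • expDelta m) * a, Sq (expDelta (m + 1)) * a, 0)

/-- The right action of `A` on `D₁`. -/
def D1.rmul (x : D1) (a : SteenrodAlgebra) : D1 :=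
  (x.1 * a, x.2.1 * a, x.2.2.mapRange (fun b => b * a) (zero_mulA a))

/-- The left action of `A` on `D₁`: `a μ₀ = μ₀ a + κ(a)` and
`a U_{k,l} = ∑_{i,j ≥ 0} U_{k+i,l+j} cont(ξ_i^{2^{k+1}} ξ_j^{2^{l+1}}, a)`. -/
def D1.lmul (a : SteenrodAlgebra) (x : D1) : D1 :=
  D1.incl (a * x.1) + (D1.mu (a * x.2.1) + D1.incl (kappa a * x.2.1)) +
    x.2.2.sum fun p b =>
      ∑ i ∈ Finset.range (maxIndex a + 1), ∑ j ∈ Finset.range (maxIndex a + 1),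
        D1.U (p.1.1 + i) (p.1.2 + j)
          (cont (2 ^ p.1.1 • expDelta i + 2 ^ p.1.2 • expDelta j) a * b)

/-- `∂ : D₁ → D₀` with `∂ a = 0`, `∂ (μ₀ a) = 2a`, `∂ (U_{k,l} a) = Y_{k,l} a`. -/
def D1.bdry (x : D1) : D0 :=
  (Finsupp.mapRange (fun z : ZMod 2 => 2 * lift z) (by decide) x.2.1, x.2.2)

/-! ## Massey products -/

/-- A choice of sections `σ : A → D₀` of `π` and `u : R_D → D₁` of `∂`. -/
structure Sections where
  σ : SteenrodAlgebra → D0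
  σ_zero : σ 0 = 0
  proj_σ : ∀ a, proj (σ a) = a
  u : RD →+ D1
  bdry_u : ∀ r : RD, (u r).bdry = r

/-- `τ(a, b) = u(σ(ab) - σ(a)σ(b))`. -/
def Sections.tau (S : Sections) (a b : SteenrodAlgebra) : D1 :=
  S.u ⟨S.σ (a * b) - S.σ a * S.σ b, by
    rw [AddMonoidHom.mem_ker, map_sub, proj_mul, S.proj_σ, S.proj_σ, S.proj_σ, sub_self]⟩

/-- `⟨a, b, c⟩ = τ(ab, c) - τ(a, b)σ(c) - τ(a, bc) + σ(a)τ(b, c)`, computed with given sections.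
Here `D₀` acts on `D₁` through `π`. -/
def Sections.bracket (S : Sections) (a b c : SteenrodAlgebra) : D1 :=
  S.tau (a * b) c - (S.tau a b).rmul (proj (S.σ c)) - S.tau a (b * c)
    + D1.lmul (proj (S.σ a)) (S.tau b c)

/-- The set of values in `A` of the Massey product `⟨a, b, c⟩`, for all choices of sections. -/
def massey (a b c : SteenrodAlgebra) : Set SteenrodAlgebra :=
  {x | ∃ S : Sections, S.bracket a b c = D1.incl x}

/-- The map `ℤ/4 → ℤ/2` with `2z ↦ z` on even elements. -/
def half (z : ZMod 4) : ZMod 2 := ((z.val / 2 : ℕ) : ZMod 2)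

theorem half_zero : half 0 = 0 := by decide

theorem lift_zero : lift 0 = 0 := by decide

theorem half_add : ∀ z w : ZMod 4, ZMod.castHom (show 2 ∣ 4 by norm_num) (ZMod 2) z = 0 →
    ZMod.castHom (show 2 ∣ 4 by norm_num) (ZMod 2) w = 0 → half (z + w) = half z + half w := by
  decide

theorem two_mul_lift_half : ∀ z : ZMod 4,
    ZMod.castHom (show 2 ∣ 4 by norm_num) (ZMod 2) z = 0 → 2 * lift (half z) = z := by
  decide

theorem cast_lift : ∀ z : ZMod 2,
    ZMod.castHom (show 2 ∣ 4 by norm_num) (ZMod 2) (lift z) = z := by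
  decide

theorem RD.cast_eq_zero (r : RD) (R : Exponent) :
    ZMod.castHom (show 2 ∣ 4 by norm_num) (ZMod 2) (r.1.1 R) = 0 := by
  rw [← proj_apply, (AddMonoidHom.mem_ker).1 r.2]
  rfl

/-- The sections `σ(∑ c_i Sq(R_i)) = ∑ ĉ_i Sq(R_i)`, with `ĉ` the lift of `c` to `{0, 1} ⊆ ℤ/4`, and
`u(2 Sq(R)) = μ₀ Sq(R)`, `u(Y_{k,l} Sq(R)) = U_{k,l} Sq(R)` for `k < l`. -/
def standardSections : Sections where
  σ a := (Finsupp.mapRange (M := ZMod 2) lift lift_zero a, 0)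
  σ_zero := Prod.ext (Finsupp.mapRange_zero (hf := lift_zero)) rfl
  proj_σ _ := Finsupp.ext (M := ZMod 2) fun _ => cast_lift _
  u :=
    { toFun := fun r => (0, Finsupp.mapRange half half_zero r.1.1, r.1.2)
      map_zero' := Prod.ext rfl (Prod.ext (Finsupp.mapRange_zero (hf := half_zero)) rfl)
      map_add' := fun r s => Prod.ext (add_zero _).symm <| Prod.ext
        (Finsupp.ext (M := ZMod 2) fun R =>
          half_add _ _ (RD.cast_eq_zero r R) (RD.cast_eq_zero s R)) rfl }
  bdry_u r := Prod.ext (x := (_ : D0)) (y := (r : D0))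
    (Finsupp.ext (M := ZMod 4) fun R => two_mul_lift_half _ (RD.cast_eq_zero r R)) rfl

end

end SecondarySteenrod

open SecondarySteenrod (P Sq massey standardSections expDelta D1.incl)

/-! Write a = P_t^s with n = t - 1 ≥ s, so that a = Sq(2^s Δ_t) is `Sq (Finsupp.single n (2 ^ s))`.
Since a² = 0 and σ(0) = 0, the terms τ(a², a) and τ(a, a²) vanish, and since 2 D₁ = 0 the bracket is
τ(a,a) a + a τ(a,a) with τ(a,a) = u(-σ(a)²) (`Sections.bracket_self`).

The square σ(a)² does not vanish in D₀. Its Sq part is binom(2^{s+1}, 2^s) Sq(2^{s+1} Δ_t), and this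
binomial coefficient is 2 modulo 4. A Y part can come only from the term ξ_t^{2^n} ⊗ ξ_t of
Δξ_{n,2n+1}, which is too large on the left unless s = n. Hence τ(a,a) = μ₀M, with the extra summand
U_{n-1,2n} b if s = n, where M = Sq(2^{s+1} Δ_t) and b = Sq((2^n - 1) Δ_t) (`tau_Sq_single`).

If s < n, then M commutes with a and κ(a) = 0, so everything cancels.

If s = n, then a U_{n-1,2n} b = U_{n-1,2n} ab + U_{2n,2n} b (`sum_U_cont`). The U parts cancel
because a and b commute. The relation U_{2n,2n} = μ₀ Sq(Δ_{2t}) + Sq(2Δ_{2t-1}) contributes μ₀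
Sq(Δ_{2t}) b, which is precisely the commutator of M and a (`Sq_commutator_top`), and leaves
Sq(2Δ_{2t-1}) b + κ(a) M in A. For t ≥ 2 the second term is zero and the first is a single Milnor
basis element; for t = 1 both equal Sq².

All products needed have factors Sq(cΔ_p) and Sq(dΔ_q), so only the coefficients of ξ_p^c ⊗ ξ_q^d in
coproducts matter, and these survive setting all other variables to zero (`restrict`). -/

namespace SecondarySteenrod

open MvPolynomial

noncomputable section

/-! ## Coefficients of monomials in one left and one right variable -/

/-- The substitution `k[σ ⊕ σ] → k[x][y]` with `X (inl a) ↦ x`, `X (inr b) ↦ y`, and all other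
variables sent to zero. -/
def restrict {σ : Type*} [DecidableEq σ] (k : Type*) [CommRing k] (a b : σ) :
    MvPolynomial (σ ⊕ σ) k →ₐ[k] Polynomial (Polynomial k) :=
  aeval (Sum.elim (fun i => if i = a then Polynomial.C Polynomial.X else 0)
    (fun i => if i = b then Polynomial.X else 0))

/-- In k[x][y] the outer `coeff` reads the exponent of y, the right tensor factor, and the inner one
that of x, the left factor. -/
theorem coeff_coeff_C_X_pow_mul_X_pow {k : Type*} [CommRing k] (m n c d : ℕ) :
    (((Polynomial.C Polynomial.X : Polynomial (Polynomial k)) ^ m *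
      Polynomial.X ^ n).coeff d).coeff c = if m = c ∧ n = d then 1 else 0 := by
  rw [← Polynomial.C_pow, Polynomial.coeff_C_mul, Polynomial.coeff_X_pow]
  by_cases h1 : d = n
  · subst h1
    simp [Polynomial.coeff_X_pow, eq_comm]
  · simp [h1, Ne.symm h1]

theorem coeff_restrict {σ k : Type*} [DecidableEq σ] [CommRing k] (a b : σ) (c d : ℕ)
    (f : MvPolynomial (σ ⊕ σ) k) :
    ((restrict k a b f).coeff d).coeff c =
      coeff ((Finsupp.single a c).sumElim (Finsupp.single b d)) f := by
  induction f using MvPolynomial.induction_on' with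
  | add p q hp hq => simp only [map_add, Polynomial.coeff_add, hp, hq, coeff_add]
  | monomial m z =>
    rw [coeff_monomial, restrict, aeval_monomial, Polynomial.algebraMap_apply,
      Polynomial.algebraMap_eq, Polynomial.coeff_C_mul, Polynomial.coeff_C_mul]
    by_cases h : ∀ i ∈ m.support, i = Sum.inl a ∨ i = Sum.inr b
    · have hm : m = (Finsupp.single a (m (Sum.inl a))).sumElim
          (Finsupp.single b (m (Sum.inr b))) := by
        ext i
        rcases i with i | i
        · by_cases hi : i = a
          · simp [hi]
          · have : m (Sum.inl i) = 0 := by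
              by_contra h0
              simpa [hi] using h _ (Finsupp.mem_support_iff.2 h0)
            simp [this, Ne.symm hi]
        · by_cases hi : i = b
          · simp [hi]
          · have : m (Sum.inr i) = 0 := by
              by_contra h0
              simpa [hi] using h _ (Finsupp.mem_support_iff.2 h0)
            simp [this, Ne.symm hi]
      have hp : (m.prod fun i e => Sum.elim
          (fun i => if i = a then (Polynomial.C Polynomial.X : Polynomial (Polynomial k)) else 0)
          (fun i => if i = b then Polynomial.X else 0) i ^ e) =
          Polynomial.C Polynomial.X ^ m (Sum.inl a) * Polynomial.X ^ m (Sum.inr b) := by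
        conv_lhs => rw [hm]
        rw [Finsupp.prod_sumElim, Finsupp.prod_single_index (by simp),
          Finsupp.prod_single_index (by simp)]
        simp
      rw [hp, coeff_coeff_C_X_pow_mul_X_pow]
      have : (m (Sum.inl a) = c ∧ m (Sum.inr b) = d) ↔
          m = (Finsupp.single a c).sumElim (Finsupp.single b d) := by
        constructor
        · rintro ⟨rfl, rfl⟩
          exact hm
        · intro h
          rw [h]
          simp
      simp [this]
    -- Some other variable occurs in `m`, so its image is zero, and `m` is not the exponent on the
    -- right either.
    · push Not at h
      obtain ⟨i, hi, h1, h2⟩ := h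
      rw [if_neg, Finsupp.prod, Finset.prod_eq_zero hi]
      · simp
      · rw [Finsupp.mem_support_iff] at hi
        rcases i with i | i
        · have h1 : i ≠ a := by simpa using h1
          simp [h1, hi]
        · have h1 : i ≠ b := by simpa using h2
          simp [h1, hi]
      · rintro rfl
        rw [Finsupp.mem_support_iff] at hi
        rcases i with i | i
        · have h1 : i ≠ a := by simpa using h1
          simp [h1] at hi
        · have h1 : i ≠ b := by simpa using h2
          simp [h1] at hi

theorem coeff_coeff_eq_zero_of_dvd {k : Type*} [CommRing k] {N c : ℕ} (hc : c < N) (d : ℕ)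
    {f : Polynomial (Polynomial k)} (hf : Polynomial.C Polynomial.X ^ N ∣ f) :
    (f.coeff d).coeff c = 0 := by
  obtain ⟨g, rfl⟩ := hf
  rw [← Polynomial.C_pow, Polynomial.coeff_C_mul, Polynomial.coeff_X_pow_mul', if_neg (by omega)]

theorem coeff_coeff_add_pow {k : Type*} [CommRing k] (r c d : ℕ) :
    (((Polynomial.X + Polynomial.C Polynomial.X : Polynomial (Polynomial k)) ^ r).coeff d).coeff c =
      if r = c + d then ((c + d).choose c : k) else 0 := by
  rw [Polynomial.coeff_X_add_C_pow, ← Polynomial.C_eq_natCast, Polynomial.coeff_mul_C,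
    Polynomial.coeff_X_pow]
  split_ifs with h1 h2 h2
  · rw [h2, one_mul, Nat.choose_symm_add]
  · rw [Nat.choose_eq_zero_of_lt (by omega)]
    simp
  · omega
  · simp

theorem eq_single_of_forall_ne {R : Exponent} {n : ℕ} (h : ∀ i, i ≠ n → R i = 0) :
    R = Finsupp.single n (R n) := by
  ext i
  by_cases hi : i = n
  · simp [hi]
  · rw [h i hi, Finsupp.single_eq_of_ne hi]

theorem prod_pow_single {K : Type*} [CommRing K] (g : ℕ → K) (n e : ℕ) :
    ((Finsupp.single n e).prod fun i e => g i ^ e) = g n ^ e :=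
  Finsupp.prod_single_index (pow_zero _)

theorem prod_pow_add {K : Type*} [CommRing K] (g : ℕ → K) (R S : Exponent) :
    ((R + S).prod fun i e => g i ^ e) =
      (R.prod fun i e => g i ^ e) * S.prod fun i e => g i ^ e :=
  Finsupp.prod_add_index' (fun _ => pow_zero _) (fun _ _ _ => pow_add _ _ _)

theorem dvd_finsuppProd {K : Type*} [CommRing K] {x : K} {g : ℕ → K} {R : Exponent} {i : ℕ}
    (hi : R i ≠ 0) (h : x ∣ g i) : x ∣ R.prod fun i e => g i ^ e :=
  (h.trans (dvd_pow_self _ hi)).trans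
    (Finset.dvd_prod_of_mem (fun i => g i ^ R i) (Finsupp.mem_support_iff.2 hi))

/-- The coefficient of `x^c y^d` in a product of powers of `x + y` and of multiples of `x^N`,
`c < N`. -/
theorem coeff_coeff_prod_add {k : Type*} [CommRing k] {g : ℕ → Polynomial (Polynomial k)}
    {n N c : ℕ} (hc : c < N) (d : ℕ) (hn : g n = Polynomial.X + Polynomial.C Polynomial.X)
    (hg : ∀ i, i ≠ n → Polynomial.C Polynomial.X ^ N ∣ g i) (R : Exponent) :
    ((R.prod fun i e => g i ^ e).coeff d).coeff c =
      if R = Finsupp.single n (c + d) then ((c + d).choose c : k) else 0 := by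
  by_cases h : ∀ i, i ≠ n → R i = 0
  · rw [eq_single_of_forall_ne h, prod_pow_single, hn,
      coeff_coeff_add_pow]
    exact if_congr (Finsupp.single_injective n).eq_iff.symm rfl rfl
  · push Not at h
    obtain ⟨i, hi, h0⟩ := h
    rw [coeff_coeff_eq_zero_of_dvd hc d (dvd_finsuppProd h0 (hg i hi)), if_neg]
    rintro rfl
    exact h0 (Finsupp.single_eq_of_ne hi)

/-- The coefficient of `x^c y^d` in a product of powers of `x`, `y` and of multiples of `x^N`,
`c < N`. -/
theorem coeff_coeff_prod_mul {k : Type*} [CommRing k] {g : ℕ → Polynomial (Polynomial k)}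
    {p q N c : ℕ} (hpq : p ≠ q) (hc : c < N) (d : ℕ) (hp : g p = Polynomial.C Polynomial.X)
    (hq : g q = Polynomial.X)
    (hg : ∀ i, i ≠ p → i ≠ q → Polynomial.C Polynomial.X ^ N ∣ g i) (R : Exponent) :
    ((R.prod fun i e => g i ^ e).coeff d).coeff c =
      if R = Finsupp.single p c + Finsupp.single q d then 1 else 0 := by
  by_cases h : ∀ i, i ≠ p → i ≠ q → R i = 0
  · have hR : R = Finsupp.single p (R p) + Finsupp.single q (R q) := by
      ext i
      by_cases h1 : i = p
      · subst h1
        simp [hpq]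
      · by_cases h2 : i = q
        · subst h2
          simp [hpq.symm]
        · simp [h i h1 h2, Ne.symm h1, Ne.symm h2]
    have h2 : (R.prod fun i e => g i ^ e) =
        Polynomial.C Polynomial.X ^ R p * Polynomial.X ^ R q := by
      conv_lhs => rw [hR]
      rw [prod_pow_add,
        prod_pow_single, prod_pow_single, hp, hq]
    rw [h2, coeff_coeff_C_X_pow_mul_X_pow]
    refine if_congr ⟨?_, ?_⟩ rfl rfl
    · rintro ⟨rfl, rfl⟩
      exact hR
    · intro h
      rw [h]
      simp [hpq, hpq.symm]
  · push Not at h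
    obtain ⟨i, hi, hi', h0⟩ := h
    rw [coeff_coeff_eq_zero_of_dvd hc d (dvd_finsuppProd h0 (hg i hi hi')), if_neg]
    rintro rfl
    exact h0 (by simp [Ne.symm hi, Ne.symm hi'])

/-- The coefficient of `x^N y^(d+1)` in a product of powers of `x + y` and `x^N y`. -/
theorem coeff_coeff_prod_add_top {k : Type*} [CommRing k] {g : ℕ → Polynomial (Polynomial k)}
    {n m N : ℕ} (hnm : n ≠ m) (hN : N ≠ 0) (d : ℕ)
    (hn : g n = Polynomial.X + Polynomial.C Polynomial.X)
    (hm : g m = Polynomial.C Polynomial.X ^ N * Polynomial.X)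
    (hg : ∀ i, i ≠ n → i ≠ m → g i = 0) (R : Exponent) :
    ((R.prod fun i e => g i ^ e).coeff (d + 1)).coeff N =
      (if R = Finsupp.single n (N + (d + 1)) then ((N + (d + 1)).choose N : k) else 0) +
        if R = Finsupp.single m 1 + Finsupp.single n d then 1 else 0 := by
  by_cases h0 : R m = 0
  · rw [if_neg (c := R = Finsupp.single m 1 + Finsupp.single n d), add_zero]
    · have h1 : (R.prod fun i e => g i ^ e) =
          R.prod fun i e => (Function.update g m 0) i ^ e := by
        refine Finsupp.prod_congr fun i hi => ?_
        rw [Function.update_of_ne]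
        rintro rfl
        exact Finsupp.mem_support_iff.1 hi h0
      rw [h1]
      refine coeff_coeff_prod_add (Nat.lt_succ_self N) _ ?_ ?_ R
      · rw [Function.update_of_ne hnm, hn]
      · intro i hi
        by_cases h2 : i = m
        · simp [h2]
        · simp [h2, hg i hi h2]
    · rintro rfl
      simp at h0
  · obtain ⟨S, hS⟩ : ∃ S, R = Finsupp.single m 1 + S :=
      ⟨R - Finsupp.single m 1, (add_tsub_cancel_of_le (Finsupp.single_le_iff.2 (by omega))).symm⟩
    subst hS
    -- One factor x^N y already uses up the whole x-degree, so what remains is the coefficient of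
    -- x^0 y^d, where any further g_m contributes nothing.
    rw [prod_pow_add,
      prod_pow_single, hm, pow_one, mul_assoc, ← Polynomial.C_pow,
      Polynomial.coeff_C_mul, Polynomial.coeff_X_mul, Polynomial.coeff_X_pow_mul',
      if_pos le_rfl, Nat.sub_self, coeff_coeff_prod_add (n := n) (Nat.pos_of_ne_zero hN) d hn]
    · rw [if_neg (c := Finsupp.single m 1 + S = Finsupp.single n (N + (d + 1))), zero_add]
      · simp
      · intro h
        have := DFunLike.congr_fun h m
        simp [hnm] at this
    · intro i hi
      by_cases h2 : i = m
      · subst h2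
        exact hm ▸ Dvd.intro _ rfl
      · simp [hg i hi h2]

/-! ## Coproducts restricted to one left and one right variable -/

theorem xi_ite {K : Type*} [CommRing K] (q : ℕ) (y : K) (j : ℕ) :
    xi (fun i => if i = q then y else 0) j =
      (if j = 0 then 1 else 0) + if j = q + 1 then y else 0 := by
  cases j <;> simp [xi]

theorem xi_map {K L : Type*} [CommRing K] [CommRing L] (φ : K →+* L) (v : ℕ → K) (n : ℕ) :
    φ (xi v n) = xi (fun i => φ (v i)) n := by
  cases n <;> simp [xi]

theorem xiSub_map {K L : Type*} [CommRing K] [CommRing L] (φ : K →+* L) (v : ℕ → K) (n k : ℕ) :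
    φ (xiSub v n k) = xiSub (fun i => φ (v i)) n k := by
  unfold xiSub
  split_ifs
  · exact xi_map φ v _
  · exact map_zero φ

/-- The right factor ξ_j survives only for j = 0 and j = q + 1; the latter meets ξ_0 = 1 or ξ_{p+1}
= x on the left. Stated over any ring because it serves both A_* and the modulo 4 coproduct, whose
additional terms contain some ξ_{k,l} and are killed. -/
theorem sum_xiSub_mul_xi_ite {K : Type*} [CommRing K] (p q : ℕ) (x y : K) (n : ℕ) :
    ∑ j ∈ Finset.range (n + 2), xiSub (fun i => if i = p then x else 0) (n + 1) j ^ 2 ^ j *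
        xi (fun i => if i = q then y else 0) j =
      (if n = p then x else 0) + (if n = q then y else 0) +
        if n = p + q + 1 then x ^ 2 ^ (q + 1) * y else 0 := by
  simp only [xi_ite q y, mul_add, Finset.sum_add_distrib, mul_ite, mul_one, mul_zero,
    Finset.sum_ite_eq', Finset.mem_range]
  rw [if_pos (by omega), add_assoc]
  congr 1
  · simp [xiSub, xi]
  · by_cases h1 : q ≤ n
    · rw [if_pos (by omega), xiSub, if_pos (by omega), xi_ite]
      by_cases h2 : n = q
      · subst h2
        rw [if_pos (by omega), if_neg (by omega), if_pos rfl, if_neg (by omega)]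
        simp
      · have h3 : n + 1 - (q + 1) ≠ 0 := by omega
        by_cases h4 : n = p + q + 1
        · have h5 : n + 1 - (q + 1) = p + 1 := by omega
          rw [if_neg h3, if_pos h5, if_neg h2, if_pos h4, zero_add, zero_add]
        · have h5 : n + 1 - (q + 1) ≠ p + 1 := by omega
          rw [if_neg h3, if_neg h5, if_neg h2, if_neg h4, add_zero,
            zero_pow (by positivity), zero_mul]
    · have h2 : n ≠ q := by omega
      have h3 : n ≠ p + q + 1 := by omega
      rw [if_neg (by omega), if_neg h2, if_neg h3, add_zero]

/-- The right factor forces k = r. On the left ξ_{n-r} and ξ_{m-r} can each be only 1 or ξ_{r+1},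
and n < m leaves n - r = 0 and m - r = r + 1. -/
theorem sum_xiSub_mul_xiSub_mul_xi_ite {K : Type*} [CommRing K] (r : ℕ) (x y : K) {n m : ℕ}
    (h : n < m) :
    ∑ k ∈ Finset.range (n + 1), xiSub (fun i => if i = r then x else 0) n k ^ 2 ^ k *
        xiSub (fun i => if i = r then x else 0) m k ^ 2 ^ k *
        xi (fun i => if i = r then y else 0) (k + 1) =
      if n = r ∧ m = 2 * r + 1 then x ^ 2 ^ r * y else 0 := by
  simp only [xi, mul_ite, mul_zero, Finset.sum_ite_eq', Finset.mem_range]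
  have h0 : (2 : ℕ) ^ r ≠ 0 := by positivity
  by_cases h1 : n < r
  · rw [if_neg (by omega), if_neg (by omega)]
  · rw [if_pos (by omega), xiSub, xiSub, if_pos (by omega), if_pos (by omega), xi_ite, xi_ite]
    rw [if_neg (c := m - r = 0) (by omega)]
    by_cases h2 : n = r
    · subst h2
      by_cases h3 : m = 2 * n + 1
      · have h4 : m - n = n + 1 := by omega
        rw [if_pos (by omega), if_neg (by omega), if_pos h4, if_pos ⟨rfl, h3⟩]
        simp
      · have h4 : m - n ≠ n + 1 := by omega
        simp [h3, h4]
    · rw [if_neg (c := n - r = 0) (by omega), if_neg (c := n = r ∧ m = 2 * r + 1) (by omega)]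
      by_cases h3 : n - r = r + 1
      · rw [if_neg (c := m - r = r + 1) (by omega)]
        simp
      · rw [if_neg h3]
        simp

theorem restrict_coprodA_X (p q n : ℕ) :
    restrict (ZMod 2) p q (coprodA (X n)) =
      (if n = p then Polynomial.C Polynomial.X else 0) + (if n = q then Polynomial.X else 0) +
        if n = p + q + 1 then Polynomial.C Polynomial.X ^ 2 ^ (q + 1) * Polynomial.X else 0 := by
  rw [← sum_xiSub_mul_xi_ite, coprodA, aeval_X, map_sum]
  refine Finset.sum_congr rfl fun j _ => ?_
  rw [map_mul, map_pow]
  congr 1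
  · congr 1
    refine (xiSub_map (restrict (ZMod 2) p q).toRingHom _ _ _).trans ?_
    simp [restrict]
  · refine (xi_map (restrict (ZMod 2) p q).toRingHom _ _).trans ?_
    simp [restrict]

theorem restrict_coprodA_monomial (p q : ℕ) (R : Exponent) :
    restrict (ZMod 2) p q (coprodA (monomial R 1)) =
      R.prod fun i e => restrict (ZMod 2) p q (coprodA (X i)) ^ e := by
  rw [monomial_eq, C_1, one_mul, Finsupp.prod, map_prod, map_prod]
  simp only [map_pow]
  rfl

theorem restrict_xiL (p q n k : ℕ) :
    restrict (ZMod 4) (Sum.inl p : Idx) (Sum.inl q) (xiL n k) =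
      xiSub (fun i => if i = p then (Polynomial.C Polynomial.X : Polynomial (Polynomial (ZMod 4)))
        else 0) n k := by
  refine (xiSub_map (restrict (ZMod 4) (Sum.inl p : Idx) (Sum.inl q)).toRingHom _ _ _).trans ?_
  simp [restrict]

theorem restrict_xiR (p q n : ℕ) :
    restrict (ZMod 4) (Sum.inl p : Idx) (Sum.inl q) (xiR n) =
      xi (fun i => if i = q then Polynomial.X else 0) n := by
  refine (xi_map (restrict (ZMod 4) (Sum.inl p : Idx) (Sum.inl q)).toRingHom _ _).trans ?_
  simp [restrict]

theorem restrict_xiPairR (p q : ℕ) (r : Pair) :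
    restrict (ZMod 4) (Sum.inl p : Idx) (Sum.inl q) (xiPairR r) = 0 := by
  simp [restrict, xiPairR]

theorem restrict_coprodDGen_inl (p q n : ℕ) :
    restrict (ZMod 4) (Sum.inl p : Idx) (Sum.inl q) (coprodDGen (Sum.inl n)) =
      (if n = p then Polynomial.C Polynomial.X else 0) + (if n = q then Polynomial.X else 0) +
        if n = p + q + 1 then Polynomial.C Polynomial.X ^ 2 ^ (q + 1) * Polynomial.X else 0 := by
  rw [← sum_xiSub_mul_xi_ite]
  simp only [coprodDGen, map_add, map_mul, map_sum, map_pow, restrict_xiL, restrict_xiR,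
    restrict_xiPairR, mul_zero, Finset.sum_const_zero, add_zero]

theorem restrict_coprodDGen_inr (r : ℕ) (p : Pair) :
    restrict (ZMod 4) (Sum.inl r : Idx) (Sum.inl r) (coprodDGen (Sum.inr p)) =
      if p.1.1 = r ∧ p.1.2 = 2 * r + 1 then
        Polynomial.C Polynomial.X ^ 2 ^ r * Polynomial.X else 0 := by
  rw [← sum_xiSub_mul_xiSub_mul_xi_ite r _ _ p.2]
  simp only [coprodDGen, map_add, map_mul, map_sum, map_pow, restrict_xiL, restrict_xiR,
    restrict_xiPairR, mul_zero, Finset.sum_const_zero, add_zero]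
  simp [restrict]

theorem restrict_coprodD_monoXi (p q : ℕ) (R : Exponent) :
    restrict (ZMod 4) (Sum.inl p : Idx) (Sum.inl q) (coprodD (monomial (monoXi R) 1)) =
      R.prod fun i e =>
        restrict (ZMod 4) (Sum.inl p : Idx) (Sum.inl q) (coprodDGen (Sum.inl i)) ^ e := by
  rw [coprodD, aeval_monomial, map_one, one_mul, monoXi,
    Finsupp.prod_mapDomain_index_inj Sum.inl_injective, Finsupp.prod, map_prod]
  simp only [map_pow]
  rfl

theorem restrict_coprodD_monoXiPair (p q : ℕ) (r : Pair) (R : Exponent) :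
    restrict (ZMod 4) (Sum.inl p : Idx) (Sum.inl q) (coprodD (monomial (monoXiPair r R) 1)) =
      restrict (ZMod 4) (Sum.inl p : Idx) (Sum.inl q) (coprodDGen (Sum.inr r)) *
      R.prod fun i e =>
        restrict (ZMod 4) (Sum.inl p : Idx) (Sum.inl q) (coprodDGen (Sum.inl i)) ^ e := by
  rw [← restrict_coprodD_monoXi, ← map_mul, monoXiPair, ← one_mul (1 : ZMod 4), ← monomial_mul,
    map_mul, one_mul]
  congr 2
  exact aeval_X _ _

/-! ## Products in the Steenrod algebra -/

theorem mul_zeroA (a : SteenrodAlgebra) : a * (0 : SteenrodAlgebra) = 0 :=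
  Finsupp.ext (M := ZMod 2) fun R => by
    change pair2 a (0 : Exponent →₀ ZMod 2) (coprodA (monomial R 1)) = 0
    exact Finset.sum_eq_zero fun _ _ => Finsupp.sum_zero_index

theorem Sq_single_mul_apply (p q c d : ℕ) (R : Exponent) :
    (show Exponent →₀ ZMod 2 from Sq (Finsupp.single p c) * Sq (Finsupp.single q d)) R =
      ((R.prod fun i e => restrict (ZMod 2) p q (coprodA (X i)) ^ e).coeff d).coeff c := by
  rw [← restrict_coprodA_monomial, coeff_restrict]
  change pair2 (Finsupp.single _ 1) (Finsupp.single _ 1) _ = _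
  simp [pair2]

/-- Below 2^(n+1) the cross term x^(2^(n+1)) y of Δξ_{2n+2} is out of reach, so the product is that
of a divided power algebra. -/
theorem Sq_single_mul_self {n c : ℕ} (d : ℕ) (hc : c < 2 ^ (n + 1)) :
    Sq (Finsupp.single n c) * Sq (Finsupp.single n d) =
      Finsupp.single (Finsupp.single n (c + d)) ((c + d).choose c : ZMod 2) := by
  refine Finsupp.ext (M := ZMod 2) fun R => (Sq_single_mul_apply _ _ _ _ R).trans ?_
  rw [coeff_coeff_prod_add (n := n) hc, Finsupp.single_apply]
  · exact if_congr eq_comm rfl rfl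
  · rw [restrict_coprodA_X, if_pos rfl, if_pos rfl, if_neg (by omega), add_zero, add_comm]
  · intro i hi
    rw [restrict_coprodA_X, if_neg hi, if_neg hi, zero_add, zero_add]
    split_ifs
    · exact Dvd.intro _ rfl
    · exact dvd_zero _

theorem Sq_single_mul_of_ne {p q c : ℕ} (d : ℕ) (hpq : p ≠ q) (hc : c < 2 ^ (q + 1)) :
    Sq (Finsupp.single p c) * Sq (Finsupp.single q d) =
      Sq (Finsupp.single p c + Finsupp.single q d) := by
  refine Finsupp.ext (M := ZMod 2) fun R => (Sq_single_mul_apply _ _ _ _ R).trans ?_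
  rw [coeff_coeff_prod_mul hpq hc]
  · refine Eq.trans ?_ (Finsupp.single_apply).symm
    exact if_congr eq_comm rfl rfl
  · rw [restrict_coprodA_X, if_pos rfl, if_neg hpq, if_neg (by omega), add_zero, add_zero]
  · rw [restrict_coprodA_X, if_pos rfl, if_neg hpq.symm, if_neg (by omega), zero_add, add_zero]
  · intro i hi hi'
    rw [restrict_coprodA_X, if_neg hi, if_neg hi', zero_add, zero_add]
    split_ifs
    · exact Dvd.intro _ rfl
    · exact dvd_zero _

/-- The exponent 2^(n+1) is the first at which the cross term ξ_{n+1}^{2^{n+1}} ⊗ ξ_{n+1} of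
Δξ_{2n+2} contributes, and it can be used only once. -/
theorem Sq_single_two_pow_mul (n d : ℕ) :
    Sq (Finsupp.single n (2 ^ (n + 1))) * Sq (Finsupp.single n (d + 1)) =
      (show SteenrodAlgebra from Finsupp.single (Finsupp.single n (2 ^ (n + 1) + (d + 1)))
        ((2 ^ (n + 1) + (d + 1)).choose (2 ^ (n + 1)) : ZMod 2)) +
      Sq (Finsupp.single (2 * n + 1) 1 + Finsupp.single n d) := by
  refine Finsupp.ext (M := ZMod 2) fun R => (Sq_single_mul_apply _ _ _ _ R).trans ?_
  rw [coeff_coeff_prod_add_top (n := n) (m := 2 * n + 1) (by omega) (by positivity)]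
  · refine Eq.trans ?_ (Finsupp.add_apply _ _ _).symm
    congr 1
    · refine Eq.trans ?_ (Finsupp.single_apply).symm
      exact if_congr eq_comm rfl rfl
    · refine Eq.trans ?_ (Finsupp.single_apply).symm
      exact if_congr eq_comm rfl rfl
  · rw [restrict_coprodA_X, if_pos rfl, if_pos rfl, if_neg (by omega), add_zero, add_comm]
  · rw [restrict_coprodA_X, if_neg (by omega), if_neg (by omega), if_pos (by omega), zero_add,
      zero_add]
  · intro i hi hi'
    rw [restrict_coprodA_X, if_neg hi, if_neg hi, if_neg (by omega), zero_add, zero_add]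

/-- The 2-adic valuation of binom(2^{s+1}, k) is s + 1 minus that of k, hence exactly 1 for k = 2^s.
-/
theorem choose_two_pow_succ_mod_four (s : ℕ) : (2 ^ (s + 1)).choose (2 ^ s) % 4 = 2 := by
  have h := Nat.Prime.emultiplicity_choose_prime_pow_add_emultiplicity Nat.prime_two
    (Nat.pow_le_pow_right two_pos s.le_succ) (pow_ne_zero s two_ne_zero)
  rw [Nat.Prime.emultiplicity_pow_self Nat.prime_two] at h
  have h1 : emultiplicity 2 ((2 ^ (s + 1)).choose (2 ^ s)) = (1 : ℕ) := by
    have h3 : ((s + 1 : ℕ) : ℕ∞) = (1 : ℕ) + (s : ℕ∞) := by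
      push_cast
      ring
    rw [h3] at h
    exact (ENat.add_left_injective_of_ne_top (ENat.natCast_ne_top s)) h
  obtain ⟨h2, h3⟩ := emultiplicity_eq_coe.1 h1
  norm_num at h2 h3
  omega

theorem SteenrodAlgebra.neg_eq (a : SteenrodAlgebra) : -a = a :=
  Finsupp.ext (M := ZMod 2) fun _ => ZMod.neg_eq_self_mod_two _

theorem D1.neg_eq (x : D1) : -x = x :=
  Prod.ext (SteenrodAlgebra.neg_eq _) <| Prod.ext (SteenrodAlgebra.neg_eq _) <|
    Finsupp.ext fun _ => SteenrodAlgebra.neg_eq _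

theorem Sq_zero_mul_single (n d : ℕ) :
    Sq 0 * Sq (Finsupp.single n d) = Sq (Finsupp.single n d) := by
  have h := Sq_single_mul_self (n := n) (c := 0) d (by positivity)
  rw [Finsupp.single_zero, zero_add, Nat.choose_zero_right, Nat.cast_one] at h
  exact h

theorem Sq_single_mul_zero (n d : ℕ) :
    Sq (Finsupp.single n d) * Sq 0 = Sq (Finsupp.single n d) := by
  -- The unit is written as a zeroth power of a variable with index large enough for d < 2^(q+1) to
  -- hold.
  have h := Sq_single_mul_of_ne (p := n) (q := n + d + 1) (c := d) 0 (by omega)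
    (Nat.lt_two_pow_self.trans (Nat.pow_lt_pow_right (by norm_num) (by omega)))
  simpa using h

theorem Sq_single_mul_comm {n c d : ℕ} (hc : c < 2 ^ (n + 1)) (hd : d < 2 ^ (n + 1)) :
    Sq (Finsupp.single n c) * Sq (Finsupp.single n d) =
      Sq (Finsupp.single n d) * Sq (Finsupp.single n c) := by
  rw [Sq_single_mul_self d hc, Sq_single_mul_self c hd, add_comm d c, Nat.choose_symm_add]

theorem Sq_single_two_pow_sq {n s : ℕ} (hs : s ≤ n) :
    Sq (Finsupp.single n (2 ^ s)) * Sq (Finsupp.single n (2 ^ s)) = 0 := by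
  rw [Sq_single_mul_self _ (Nat.pow_lt_pow_right (by norm_num) (by omega))]
  have h := choose_two_pow_succ_mod_four s
  rw [pow_succ, mul_two] at h
  have h1 : (((2 ^ s + 2 ^ s).choose (2 ^ s) : ℕ) : ZMod 2) = 0 :=
    (ZMod.natCast_eq_zero_iff _ _).2 (by omega)
  rw [h1]
  exact Finsupp.single_zero _

/-- Both products contain the same binomial multiple of Sq((2^{n+1} + 2^n) Δ_{n+1}), so only the
cross term is left. -/
theorem Sq_commutator_top (n : ℕ) :
    Sq (Finsupp.single n (2 ^ (n + 1))) * Sq (Finsupp.single n (2 ^ n)) =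
      Sq (Finsupp.single n (2 ^ n)) * Sq (Finsupp.single n (2 ^ (n + 1))) +
      Sq (Finsupp.single (2 * n + 1) 1) * Sq (Finsupp.single n (2 ^ n - 1)) := by
  have h : 2 ^ n = 2 ^ n - 1 + 1 := by have := Nat.one_le_two_pow (n := n); omega
  have h1 := Sq_single_two_pow_mul n (2 ^ n - 1)
  rw [← h] at h1
  rw [h1, Sq_single_mul_self _ (Nat.pow_lt_pow_right (by norm_num) (by omega)),
    Sq_single_mul_of_ne _ (by omega) (Nat.one_lt_two_pow (by omega)), add_comm (2 ^ n),
    Nat.choose_symm_add]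

/-! ## Squares in `D₀` -/

theorem standardSections_σ_Sq (R : Exponent) :
    standardSections.σ (Sq R) = (Finsupp.single R (1 : ZMod 4), 0) :=
  Prod.ext (Finsupp.mapRange_single (M := ZMod 2) (hf := lift_zero)) rfl

theorem toDual_σ_Sq (R : Exponent) :
    (standardSections.σ (Sq R)).toDual = Finsupp.single (monoXi R) 1 := by
  rw [standardSections_σ_Sq]
  change Finsupp.mapDomain monoXi (Finsupp.single R (1 : ZMod 4)) + 0 = _
  rw [add_zero, Finsupp.mapDomain_single]

theorem pair2_σ_Sq (p q c d : ℕ) (f : MvPolynomial (Idx ⊕ Idx) (ZMod 4)) :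
    pair2 (standardSections.σ (Sq (Finsupp.single p c))).toDual
        (standardSections.σ (Sq (Finsupp.single q d))).toDual f =
      ((restrict (ZMod 4) (Sum.inl p : Idx) (Sum.inl q) f).coeff d).coeff c := by
  rw [toDual_σ_Sq, toDual_σ_Sq, coeff_restrict]
  simp [pair2, monoXi, Finsupp.mapDomain_single]

theorem coeff_coeff_prod_coprodDGen {n c : ℕ} (d : ℕ) (hc : c < 2 ^ (n + 1)) (R : Exponent) :
    ((R.prod fun i e => restrict (ZMod 4) (Sum.inl n : Idx) (Sum.inl n)
      (coprodDGen (Sum.inl i)) ^ e).coeff d).coeff c =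
      if R = Finsupp.single n (c + d) then ((c + d).choose c : ZMod 4) else 0 := by
  refine coeff_coeff_prod_add hc _ ?_ ?_ R
  · rw [restrict_coprodDGen_inl, if_pos rfl, if_pos rfl, if_neg (by omega), add_zero, add_comm]
  · intro i hi
    rw [restrict_coprodDGen_inl, if_neg hi, if_neg hi, zero_add, zero_add]
    split_ifs
    · exact Dvd.intro _ rfl
    · exact dvd_zero _

theorem σ_sq_fst {n s : ℕ} (hs : s ≤ n) :
    (standardSections.σ (Sq (Finsupp.single n (2 ^ s))) *
      standardSections.σ (Sq (Finsupp.single n (2 ^ s)))).1 =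
      Finsupp.single (Finsupp.single n (2 ^ (s + 1))) (2 : ZMod 4) := by
  refine Finsupp.ext (M := ZMod 4) fun R => ?_
  refine (pair2_σ_Sq n n (2 ^ s) (2 ^ s) (coprodD (monomial (monoXi R) 1))).trans ?_
  rw [restrict_coprodD_monoXi, coeff_coeff_prod_coprodDGen _
    (Nat.pow_lt_pow_right (by norm_num) (by omega)), Finsupp.single_apply, ← mul_two, ← pow_succ]
  refine if_congr eq_comm ?_ rfl
  rw [← ZMod.natCast_mod, choose_two_pow_succ_mod_four]
  rfl

/-- The index of `Y_{t-2,2t-2}` and `U_{t-2,2t-2}` for `t = n + 1`. -/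
def topPair (n : ℕ) : Pair := ⟨(n, 2 * n + 1), by dsimp only; omega⟩

/-- Restricted to the two variables, Δξ_{k,l} is x^(2^n) y for (k, l) = (n, 2n+1) and zero
otherwise. Reaching x^(2^s) requires s = n, and then the remaining y^(2^n - 1) comes from ξ^R. -/
theorem σ_sq_snd {n s : ℕ} (hs : s ≤ n) :
    (standardSections.σ (Sq (Finsupp.single n (2 ^ s))) *
      standardSections.σ (Sq (Finsupp.single n (2 ^ s)))).2 =
      if s = n then Finsupp.single (topPair n) (Sq (Finsupp.single n (2 ^ n - 1))) else 0 := by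
  refine Finsupp.ext fun p => Finsupp.ext (M := ZMod 2) fun R => ?_
  refine (congrArg (ZMod.castHom (show 2 ∣ 4 by norm_num) (ZMod 2))
    (pair2_σ_Sq n n (2 ^ s) (2 ^ s) (coprodD (monomial (monoXiPair p R) 1)))).trans ?_
  rw [restrict_coprodD_monoXiPair, restrict_coprodDGen_inr]
  by_cases hp : p = topPair n
  · subst hp
    rw [if_pos ⟨rfl, rfl⟩]
    by_cases h : s = n
    · subst h
      obtain ⟨m, hm⟩ : ∃ m, 2 ^ s = m + 1 := ⟨2 ^ s - 1, by have := Nat.one_le_two_pow (n := s); omega⟩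
      have h1 : 0 + m = 2 ^ s - 1 := by omega
      rw [mul_assoc, ← Polynomial.C_pow, Polynomial.coeff_C_mul, Polynomial.coeff_X_pow_mul',
        if_pos le_rfl, Nat.sub_self, hm, Polynomial.coeff_X_mul,
        coeff_coeff_prod_coprodDGen _ (by positivity), if_pos rfl, Finsupp.single_eq_same, ← hm,
        h1]
      refine Eq.trans ?_ (Finsupp.single_apply).symm
      rw [apply_ite (ZMod.castHom (show 2 ∣ 4 by norm_num) (ZMod 2))]
      refine if_congr eq_comm ?_ (map_zero _)
      simp
    · rw [if_neg h, mul_assoc, coeff_coeff_eq_zero_of_dvd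
        (Nat.pow_lt_pow_right (by norm_num) (show s < n by omega)) _ (Dvd.intro _ rfl), map_zero]
      rfl
  · rw [if_neg, zero_mul, Polynomial.coeff_zero, Polynomial.coeff_zero, map_zero]
    · split_ifs
      · rw [Finsupp.single_eq_of_ne hp]
        rfl
      · rfl
    · rintro ⟨h1, h2⟩
      exact hp (Subtype.ext (Prod.ext h1 h2))

/-! ## Contractions and the bimodule structure -/

theorem cont_Sq_of_le {S R : Exponent} (h : S ≤ R) : cont S (Sq R) = Sq (R - S) := by
  refine Finsupp.ext (M := ZMod 2) fun T => ?_
  refine Eq.trans (Finsupp.single_apply (a := R) (a' := S + T)) ?_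
  refine Eq.trans ?_ (Finsupp.single_apply).symm
  refine if_congr ⟨?_, ?_⟩ rfl rfl
  · rintro rfl
    exact add_tsub_cancel_left _ _
  · rintro rfl
    exact (add_tsub_cancel_of_le h).symm

theorem cont_Sq_of_not_le {S R : Exponent} (h : ¬ S ≤ R) : cont S (Sq R) = 0 := by
  refine Finsupp.ext (M := ZMod 2) fun T => ?_
  refine (Finsupp.single_apply (a := R) (a' := S + T)).trans (if_neg ?_)
  rintro rfl
  exact h le_self_add

theorem D1.U_of_lt {m n : ℕ} (h : m < n) (a : SteenrodAlgebra) :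
    D1.U m n a = ((0 : SteenrodAlgebra), (0 : SteenrodAlgebra), Finsupp.single ⟨(m, n), h⟩ a) :=
  dif_pos h

theorem D1.U_of_gt {m n : ℕ} (h : n < m) (a : SteenrodAlgebra) :
    D1.U m n a = (Sq (expDelta m + expDelta n) * a, (0 : SteenrodAlgebra),
      Finsupp.single ⟨(n, m), h⟩ a) :=
  (dif_neg h.asymm).trans (dif_pos h)

theorem D1.U_self (m : ℕ) (a : SteenrodAlgebra) :
    D1.U m m a = (Sq (2 • expDelta m) * a, Sq (expDelta (m + 1)) * a,
      (0 : Pair →₀ SteenrodAlgebra)) :=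
  (dif_neg (lt_irrefl m)).trans (dif_neg (lt_irrefl m))

theorem D1.U_zero (m n : ℕ) : D1.U m n 0 = 0 := by
  rcases lt_trichotomy m n with h | rfl | h
  · exact (D1.U_of_lt h 0).trans (Prod.ext rfl (Prod.ext rfl (Finsupp.single_zero _)))
  · exact (D1.U_self m 0).trans (Prod.ext (mul_zeroA _) (Prod.ext (mul_zeroA _) rfl))
  · exact (D1.U_of_gt h 0).trans (Prod.ext (mul_zeroA _) (Prod.ext rfl (Finsupp.single_zero _)))

theorem D1.U_zero_mul (m n : ℕ) (b : SteenrodAlgebra) : D1.U m n ((0 : SteenrodAlgebra) * b) = 0 := by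
  rw [zero_mulA, D1.U_zero]

theorem maxIndex_Sq_single {n c : ℕ} (hc : c ≠ 0) : maxIndex (Sq (Finsupp.single n c)) = n + 1 := by
  unfold maxIndex Sq
  rw [Finsupp.support_single (M := ZMod 2) _ one_ne_zero, Finset.sup_singleton,
    Finsupp.support_single _ hc, Finset.sup_singleton]

/-- Contraction of Sq(2^n Δ_{n+1}) by ξ_i^{2^n} is nonzero only for i = 0 and i = n + 1, and by
ξ_j^{2^{2n+1}} only for j = 0. -/
theorem sum_U_cont (n : ℕ) (b : SteenrodAlgebra) :
    (∑ i ∈ Finset.range (maxIndex (Sq (Finsupp.single n (2 ^ n))) + 1),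
      ∑ j ∈ Finset.range (maxIndex (Sq (Finsupp.single n (2 ^ n))) + 1),
        D1.U (n + i) (2 * n + 1 + j)
          (cont (2 ^ n • expDelta i + 2 ^ (2 * n + 1) • expDelta j)
            (Sq (Finsupp.single n (2 ^ n))) * b)) =
      D1.U n (2 * n + 1) (Sq (Finsupp.single n (2 ^ n)) * b) +
        D1.U (2 * n + 1) (2 * n + 1) (Sq 0 * b) := by
  have hpos : 0 < 2 ^ n := by positivity
  rw [maxIndex_Sq_single hpos.ne']
  have hj : ∀ i, (∑ j ∈ Finset.range (n + 1 + 1), D1.U (n + i) (2 * n + 1 + j)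
      (cont (2 ^ n • expDelta i + 2 ^ (2 * n + 1) • expDelta j)
        (Sq (Finsupp.single n (2 ^ n))) * b)) =
      D1.U (n + i) (2 * n + 1) (cont (2 ^ n • expDelta i) (Sq (Finsupp.single n (2 ^ n))) * b) := by
    intro i
    rw [Finset.sum_eq_single 0]
    · rw [expDelta, smul_zero, add_zero, add_zero]
    · intro j _ hj0
      rw [cont_Sq_of_not_le, D1.U_zero_mul]
      intro h
      obtain ⟨j, rfl⟩ := Nat.exists_eq_succ_of_ne_zero hj0
      have h1 := h j
      have h2 : 2 ^ n < 2 ^ (2 * n + 1) := Nat.pow_lt_pow_right (by norm_num) (by omega)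
      have h3 : Finsupp.single n (2 ^ n) j ≤ 2 ^ n := by
        rw [Finsupp.single_apply]
        split_ifs <;> omega
      simp only [expDelta, Finsupp.add_apply, Finsupp.smul_apply, Finsupp.single_eq_same,
        smul_eq_mul, mul_one] at h1
      omega
    · intro h
      simp at h
  simp only [hj]
  rw [Finset.sum_eq_add 0 (n + 1) (by omega)]
  · refine congrArg₂ (· + ·) ?_ ?_
    · rw [expDelta, smul_zero, cont_Sq_of_le (zero_le), tsub_zero, add_zero]
    -- For i = n + 1 the first index catches up with the second, so the generator lies on the
    -- diagonal and is not free.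
    · rw [expDelta, Finsupp.smul_single, smul_eq_mul, mul_one, cont_Sq_of_le le_rfl, tsub_self,
        show n + (n + 1) = 2 * n + 1 by omega]
  · rintro i _ ⟨h0, hi⟩
    rw [cont_Sq_of_not_le, D1.U_zero_mul]
    obtain ⟨i, rfl⟩ := Nat.exists_eq_succ_of_ne_zero h0
    intro h
    have h1 := h i
    rw [Finsupp.single_eq_of_ne (by omega)] at h1
    simp [expDelta] at h1
  · intro h
    simp at h
  · intro h
    simp at h

theorem kappa_Sq_single {n : ℕ} (hn : n ≠ 0) (c : ℕ) : kappa (Sq (Finsupp.single n c)) = 0 :=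
  cont_Sq_of_not_le fun h => by
    have h1 := h 0
    rw [Finsupp.single_eq_of_ne hn.symm] at h1
    simp [expDelta] at h1

/-! ## The bracket of an element of square zero -/

theorem mul_eq_zero_D0 {d e : D0} (h : ∀ q, pair2 d.toDual e.toDual q = 0) : d * e = 0 :=
  Prod.ext (Finsupp.ext (M := ZMod 4) fun _ => h _)
    (Finsupp.ext fun p => Finsupp.ext (M := ZMod 2) fun R =>
      (congrArg (ZMod.castHom (show 2 ∣ 4 by norm_num) (ZMod 2))
        (h (coprodD (monomial (monoXiPair p R) 1)))).trans (map_zero _))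

theorem Sections.tau_zero_left (S : Sections) (a : SteenrodAlgebra) : S.tau 0 a = 0 := by
  refine (congrArg S.u (Subtype.ext ?_)).trans (map_zero S.u)
  change S.σ (0 * a) - S.σ 0 * S.σ a = 0
  rw [zero_mulA, S.σ_zero, zero_sub, neg_eq_zero]
  exact mul_eq_zero_D0 fun q => Finsupp.sum_zero_index

theorem Sections.tau_zero_right (S : Sections) (a : SteenrodAlgebra) : S.tau a 0 = 0 := by
  refine (congrArg S.u (Subtype.ext ?_)).trans (map_zero S.u)
  change S.σ (a * 0) - S.σ a * S.σ 0 = 0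
  rw [mul_zeroA, S.σ_zero, zero_sub, neg_eq_zero]
  exact mul_eq_zero_D0 fun q => Finset.sum_eq_zero fun _ _ => Finsupp.sum_zero_index

theorem Sections.bracket_self (S : Sections) {a : SteenrodAlgebra} (h : a * a = 0) :
    S.bracket a a a = (S.tau a a).rmul a + D1.lmul a (S.tau a a) := by
  unfold Sections.bracket
  rw [h, S.tau_zero_left, S.tau_zero_right, S.proj_σ, zero_sub, sub_zero, D1.neg_eq]

theorem tau_Sq_single {n s : ℕ} (hs : s ≤ n) :
    standardSections.tau (Sq (Finsupp.single n (2 ^ s))) (Sq (Finsupp.single n (2 ^ s))) =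
      ((0 : SteenrodAlgebra), Sq (Finsupp.single n (2 ^ (s + 1))),
        if s = n then Finsupp.single (topPair n) (Sq (Finsupp.single n (2 ^ n - 1))) else 0) := by
  set a := Sq (Finsupp.single n (2 ^ s)) with ha
  have h0 : standardSections.σ (a * a) = 0 := by
    rw [ha, Sq_single_two_pow_sq hs, standardSections.σ_zero]
  refine Prod.ext rfl (Prod.ext ?_ ?_)
  · change Finsupp.mapRange half half_zero
      (standardSections.σ (a * a) - standardSections.σ a * standardSections.σ a).1 = _
    rw [h0, zero_sub]
    change Finsupp.mapRange half half_zero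
      (-(standardSections.σ a * standardSections.σ a).1) = _
    -- The sign is harmless because -2 = 2 in ℤ/4.
    rw [ha, σ_sq_fst hs, ← Finsupp.single_neg, Finsupp.mapRange_single]
    rfl
  · change (standardSections.σ (a * a) - standardSections.σ a * standardSections.σ a).2 = _
    rw [h0, zero_sub]
    refine Eq.trans ?_ (σ_sq_snd hs)
    exact Finsupp.ext fun p => SteenrodAlgebra.neg_eq _

/-! ### Evaluation of the bracket of Sq(2^s Δ_t) by components -/

theorem SteenrodAlgebra.add_self (a : SteenrodAlgebra) : a + a = 0 :=
  (congrArg (a + ·) (SteenrodAlgebra.neg_eq a).symm).trans (add_neg_cancel a)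

theorem D1.rmul_single (M : SteenrodAlgebra) (p : Pair) (b a : SteenrodAlgebra) :
    D1.rmul ((0 : SteenrodAlgebra), M, Finsupp.single p b) a =
      ((0 : SteenrodAlgebra), M * a, Finsupp.single p (b * a)) :=
  Prod.ext (zero_mulA a) (Prod.ext rfl (Finsupp.mapRange_single (hf := zero_mulA a)))

theorem bracket_Sq_single_of_lt {n s : ℕ} (hs : s < n) :
    standardSections.bracket (Sq (Finsupp.single n (2 ^ s))) (Sq (Finsupp.single n (2 ^ s)))
      (Sq (Finsupp.single n (2 ^ s))) = 0 := by
  rw [Sections.bracket_self _ (Sq_single_two_pow_sq hs.le), tau_Sq_single hs.le, if_neg hs.ne]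
  have h1 : 2 ^ s < 2 ^ (n + 1) := Nat.pow_lt_pow_right (by norm_num) (by omega)
  have h2 : 2 ^ (s + 1) < 2 ^ (n + 1) := Nat.pow_lt_pow_right (by norm_num) (by omega)
  have h3 := Sq_single_mul_comm h1 h2
  have h4 := kappa_Sq_single (n := n) (by omega) (2 ^ s)
  generalize Sq (Finsupp.single n (2 ^ s)) = a at *
  generalize Sq (Finsupp.single n (2 ^ (s + 1))) = M at *
  refine Prod.ext ?_ (Prod.ext ?_ ?_)
  · change 0 * a + (a * 0 + (0 + kappa a * M) + 0) = 0
    rw [h4, zero_mulA, zero_mulA, mul_zeroA]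
    simp
  · change M * a + (0 + (a * M + 0) + 0) = 0
    rw [h3, add_zero, zero_add, add_zero, SteenrodAlgebra.add_self]
  · change Finsupp.mapRange (fun b => b * a) (zero_mulA a) 0 + (0 + (0 + 0) + 0) = 0
    rw [Finsupp.mapRange_zero]
    simp

/-- The κ term is kept so that n = 0 is covered: it vanishes for n ≥ 1 and cancels the other term
for n = 0. -/
theorem bracket_Sq_single_top (n : ℕ) :
    standardSections.bracket (Sq (Finsupp.single n (2 ^ n))) (Sq (Finsupp.single n (2 ^ n)))
      (Sq (Finsupp.single n (2 ^ n))) =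
    D1.incl (kappa (Sq (Finsupp.single n (2 ^ n))) * Sq (Finsupp.single n (2 ^ (n + 1))) +
      Sq (Finsupp.single (2 * n) 2) * Sq (Finsupp.single n (2 ^ n - 1))) := by
  rw [Sections.bracket_self _ (Sq_single_two_pow_sq le_rfl), tau_Sq_single le_rfl, if_pos rfl]
  have h1 : 2 ^ n < 2 ^ (n + 1) := Nat.pow_lt_pow_right (by norm_num) (by omega)
  have h2 : 2 ^ n - 1 < 2 ^ (n + 1) := by omega
  have h3 := Sq_single_mul_comm h1 h2
  have h4 := Sq_commutator_top n
  have h5 := sum_U_cont n (Sq (Finsupp.single n (2 ^ n - 1)))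
  have h6 : 2 • expDelta (2 * n + 1) = Finsupp.single (2 * n) 2 := by
    rw [expDelta, Finsupp.smul_single, smul_eq_mul, mul_one]
  rw [Sq_zero_mul_single, D1.U_of_lt (by omega), D1.U_self, h6] at h5
  generalize Sq (Finsupp.single n (2 ^ n)) = a at *
  generalize Sq (Finsupp.single n (2 ^ n - 1)) = b at *
  generalize Sq (Finsupp.single n (2 ^ (n + 1))) = M at *
  generalize Sq (Finsupp.single (2 * n) 2) = c at *
  have h7 : D1.lmul a ((0 : SteenrodAlgebra), M, Finsupp.single (topPair n) b) =
      D1.incl (a * 0) + (D1.mu (a * M) + D1.incl (kappa a * M)) +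
        ((show D1 from
            ((0 : SteenrodAlgebra), (0 : SteenrodAlgebra), Finsupp.single (topPair n) (a * b))) +
          (show D1 from
            (c * b, Sq (Finsupp.single (2 * n + 1) 1) * b, (0 : Pair →₀ SteenrodAlgebra)))) := by
    refine congrArg (D1.incl (a * 0) + (D1.mu (a * M) + D1.incl (kappa a * M)) + ·) ?_
    refine (Finsupp.sum_single_index ?_).trans h5
    refine Finset.sum_eq_zero fun i _ => Finset.sum_eq_zero fun j _ => ?_
    rw [mul_zeroA, D1.U_zero]
  rw [h7, D1.rmul_single]
  refine Prod.ext ?_ (Prod.ext ?_ ?_)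
  · change 0 + (a * 0 + (0 + kappa a * M) + (0 + c * b)) = kappa a * M + c * b
    rw [mul_zeroA]
    simp only [zero_add]
  · change M * a + (0 + (a * M + 0) + (0 + Sq (Finsupp.single (2 * n + 1) 1) * b)) = 0
    -- The μ₀ part of the diagonal generator cancels the commutator of M and a.
    rw [h4]
    simp only [zero_add, add_zero, SteenrodAlgebra.add_self]
  · change Finsupp.single (topPair n) (b * a) +
      (0 + (0 + 0) + (Finsupp.single (topPair n) (a * b) + 0)) = 0
    rw [h3]
    simp only [zero_add, add_zero, ← Finsupp.single_add, SteenrodAlgebra.add_self,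
      Finsupp.single_zero]

/-! ### The elements P_t^s -/

theorem P_succ (n s : ℕ) : P (n + 1) s = Sq (Finsupp.single n (2 ^ s)) := by
  rw [P, expDelta, Finsupp.smul_single, smul_eq_mul, mul_one]

theorem bracket_P_of_lt {t s : ℕ} (h : s + 1 < t) :
    standardSections.bracket (P t s) (P t s) (P t s) = 0 := by
  obtain ⟨n, rfl⟩ := Nat.exists_eq_succ_of_ne_zero (show t ≠ 0 by omega)
  rw [P_succ]
  exact bracket_Sq_single_of_lt (by omega)

theorem bracket_P_top {t : ℕ} (ht : 2 ≤ t) :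
    standardSections.bracket (P t (t - 1)) (P t (t - 1)) (P t (t - 1)) =
      D1.incl (Sq ((2 ^ (t - 1) - 1) • expDelta t + 2 • expDelta (2 * t - 1))) := by
  obtain ⟨n, rfl⟩ := Nat.exists_eq_succ_of_ne_zero (show t ≠ 0 by omega)
  have h1 : 2 * (n + 1) - 1 = 2 * n + 1 := by omega
  have h2 : 2 < 2 ^ (n + 1) := (pow_one 2).symm.trans_lt <| Nat.pow_lt_pow_right (by norm_num) (by omega)
  rw [Nat.succ_eq_add_one, Nat.add_sub_cancel, P_succ, bracket_Sq_single_top,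
    kappa_Sq_single (by omega), zero_mulA, zero_add, Sq_single_mul_of_ne _ (by omega) h2, h1,
    add_comm]
  simp only [expDelta, Finsupp.smul_single, smul_eq_mul, mul_one]

theorem bracket_P_one_zero : standardSections.bracket (P 1 0) (P 1 0) (P 1 0) = 0 := by
  -- Here κ(Sq¹) = 1, so the two terms in A are both Sq².
  have h1 : kappa (Sq (Finsupp.single 0 1)) = Sq 0 :=
    (cont_Sq_of_le le_rfl).trans (congrArg Sq (tsub_self _))
  have h := bracket_Sq_single_top 0
  rw [P_succ]
  refine h.trans ?_
  simp only [pow_zero, h1, mul_zero, zero_add, pow_one, tsub_self, Finsupp.single_zero,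
    Sq_zero_mul_single, Sq_single_mul_zero, SteenrodAlgebra.add_self]
  rfl

end

end SecondarySteenrod

theorem mainTheorem2 :
    (∀ t s : ℕ, 1 ≤ t → s + 1 < t →
      standardSections.bracket (P t s) (P t s) (P t s) = 0 ∧
      0 ∈ massey (P t s) (P t s) (P t s)) ∧
    (∀ t : ℕ, 2 ≤ t →
      standardSections.bracket (P t (t - 1)) (P t (t - 1)) (P t (t - 1)) =
        D1.incl (Sq ((2 ^ (t - 1) - 1) • expDelta t + 2 • expDelta (2 * t - 1))) ∧
      Sq ((2 ^ (t - 1) - 1) • expDelta t + 2 • expDelta (2 * t - 1)) ∈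
        massey (P t (t - 1)) (P t (t - 1)) (P t (t - 1))) ∧
    (standardSections.bracket (P 1 0) (P 1 0) (P 1 0) = 0 ∧
      0 ∈ massey (P 1 0) (P 1 0) (P 1 0)) ∧
    (standardSections.bracket (Sq (2 • expDelta 2)) (Sq (2 • expDelta 2)) (Sq (2 • expDelta 2)) =
        D1.incl (Sq (expDelta 2 + 2 • expDelta 3)) ∧
      Sq (expDelta 2 + 2 • expDelta 3) ∈
        massey (Sq (2 • expDelta 2)) (Sq (2 • expDelta 2)) (Sq (2 • expDelta 2))) := by
  have h1 {t s : ℕ} (h : s + 1 < t) := SecondarySteenrod.bracket_P_of_lt h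
  have h2 {t : ℕ} (ht : 2 ≤ t) := SecondarySteenrod.bracket_P_top ht
  have h3 := SecondarySteenrod.bracket_P_one_zero
  have h4 := h2 le_rfl
  simp only [P, Nat.reduceSub, Nat.reduceMul, pow_one, one_smul] at h4
  exact ⟨fun t s _ h => ⟨h1 h, standardSections, h1 h⟩,
    fun t ht => ⟨h2 ht, standardSections, h2 ht⟩, ⟨h3, standardSections, h3⟩,
    h4, standardSections, h4⟩
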